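/- Let $k$ be an algebraically closed field and let $\mathbf{C}$ be a finite length category over $k$, that is, an essentially small $k$-linear abelian category in which every object has finite length and all morphism spaces are finite dimensional. Let $\Lambda$ be a set labelling the isomorphism classes of simple objects $L(\lambda)$, $\lambda\in\Lambda$, of $\mathbf{C}$, and for $\Omega\subset\Lambda$ let $\mathbf{C}_\Omega$ be the Serre subcategory of $\mathbf{C}$ generated by the $L(\lambda)$ with $\lambda\in\Omega$. For a partial order $\le$ on $\Lambda$ write $\mathbf{C}_{\le\lambda}$ for $\mathbf{C}_\Omega$ with $\Omega=\{\mu\in\Lambda\mid\mu\le\lambda\}$; an ideal in $\Lambda$ is a subset closed under passing to smaller elements. A lower finite highest weight structure on $\mathbf{C}$ is a partial order $\le$ on $\Lambda$ for which all sets $\{\mu\in\Lambda\mid\mu\le\lambda\}$ are finite and such that for every $\lambda\in\Lambda$: (i) $L(\lambda)$ has an injective hull $\nabla(\lambda)$ and a projective cover $\Delta(\lambda)$ in $\mathbf{C}_{\le\lambda}$ (the costandard and standard objects); (ii) the multiplicity $[\nabla(\lambda):L(\lambda)]$ is $1$, and $\nabla(\lambda)$ is injective in $\mathbf{C}_\Omega$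 for every finite ideal $\Omega\ni\lambda$ in which $\lambda$ is maximal; (iii) $\mathrm{Ext}^2_{\mathbf{C}}(\Delta(\lambda),\nabla(\mu))=0$ for every $\mu\in\Lambda$. Assume that $\mathbf{C}$ admits a simple preserving anti-autoequivalence, that is, an equivalence $\Psi:\mathbf{C}^{\mathrm{op}}\to\mathbf{C}$ with $\Psi(L)\cong L$ for every simple object $L$. Then $\mathbf{C}$ admits at most one lower finite highest weight structure up to equivalence: if $\le_1$ and $\le_2$ are two such structures, with costandard objects $\nabla_1(\lambda)$ and $\nabla_2(\lambda)$, then $\nabla_1(\lambda)\cong\nabla_2(\lambda)$ for every $\lambda\in\Lambda$. -/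

import Mathlib

open CategoryTheory CategoryTheory.Limits

universe v u t

namespace LFHW

/-- A finite length category over `k`: all objects have finite length (equivalently, are both
noetherian and artinian) and all morphism spaces are finite dimensional. (A category
`C : Type u` with morphisms in `Type v` is always essentially small relative to the universe
`max u v`, so smallness is not a separate condition.) -/
class IsFiniteLengthCategory (k : Type t) [Field k] (C : Type u) [Category.{v} C] [Abelian C]
    [Linear k C] : Prop where
  noetherian : ∀ X : C, IsNoetherianObject X
  artinian : ∀ X : C, IsArtinianObject X
  finite_hom : ∀ X Y : C, Module.Finite k (X ⟶ Y)

/-- `i : S ⟶ I` is an injective hull: an essential monomorphism into an injective object. -/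
structure IsInjectiveHull {D : Type u} [Category.{v} D] {S I : D} (i : S ⟶ I) : Prop where
  injective : Injective I
  mono : Mono i
  essential : ∀ ⦃Y : D⦄ (f : I ⟶ Y), Mono (i ≫ f) → Mono f

/-- `p : P ⟶ S` is a projective cover: an essential epimorphism from a projective object. -/
structure IsProjectiveCover {D : Type u} [Category.{v} D] {P S : D} (p : P ⟶ S) : Prop where
  projective : Projective P
  epi : Epi p
  essential : ∀ ⦃Y : D⦄ (f : Y ⟶ P), Epi (f ≫ p) → Epi f

section

variable {C : Type u} [Category.{v} C] [Abelian C]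

/-- A composition series `0 = X₀ ≤ X₁ ≤ ⋯ ≤ Xₙ = X` with simple subquotients. -/
structure CompSeries (X : C) where
  length : ℕ
  term : Fin (length + 1) → Subobject X
  term_zero : term 0 = ⊥
  term_last : term (Fin.last length) = ⊤
  step : ∀ i : Fin length, term i.castSucc ≤ term i.succ
  simple : ∀ i : Fin length, Simple (cokernel (Subobject.ofLE _ _ (step i)))

/-- The `i`-th composition factor of a composition series. -/
noncomputable def CompSeries.factor {X : C} (F : CompSeries X) (i : Fin F.length) : C :=
  cokernel (Subobject.ofLE _ _ (F.step i))

/-- `[X : S] = m`: exactly `m` factors in a composition series of `X` are isomorphic to `S`.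
(By the Jordan–Hölder theorem the number does not depend on the series.) -/
def HasMultiplicity (X S : C) (m : ℕ) : Prop :=
  ∃ F : CompSeries X, Nat.card {i : Fin F.length // Nonempty (F.factor i ≅ S)} = m

/-- The Serre subcategory generated by a class of objects, that is, the smallest one that
contains it. -/
def serreGenerated (P : ObjectProperty C) : ObjectProperty C :=
  fun X => ∀ Q : ObjectProperty C, Q.IsSerreClass → P ≤ Q → Q X

/-- `Λ` labels the isomorphism classes of simple objects through `L`. -/
structure IsSimpleLabelling {Λ : Type t} (L : Λ → C) : Prop where
  simple : ∀ l, Simple (L l)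
  injective : ∀ l m, Nonempty (L l ≅ L m) → l = m
  exhaustive : ∀ S : C, Simple S → ∃ l, Nonempty (S ≅ L l)

variable {Λ : Type t} (L : Λ → C)

/-- The Serre subcategory `C_Ω` of `C` generated by the simple objects `L l`, `l ∈ Ω`. -/
def serreSub (Ω : Set Λ) : ObjectProperty C :=
  serreGenerated fun X => ∃ l ∈ Ω, Nonempty (X ≅ L l)

/-- `N` is the costandard object `∇(l)` of `(C, ≤)`: it lies in `C_{≤ l}` and is there an
injective hull of `L l`. -/
def IsCostandard (o : PartialOrder Λ) (l : Λ) (N : C) : Prop :=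
  ∃ (hL : serreSub L {m | o.le m l} (L l)) (hN : serreSub L {m | o.le m l} N)
    (i : (⟨L l, hL⟩ : (serreSub L {m | o.le m l}).FullSubcategory) ⟶ ⟨N, hN⟩),
    IsInjectiveHull i

/-- `D` is the standard object `Δ(l)` of `(C, ≤)`: it lies in `C_{≤ l}` and is there a
projective cover of `L l`. -/
def IsStandard (o : PartialOrder Λ) (l : Λ) (D : C) : Prop :=
  ∃ (hL : serreSub L {m | o.le m l} (L l)) (hD : serreSub L {m | o.le m l} D)
    (p : (⟨D, hD⟩ : (serreSub L {m | o.le m l}).FullSubcategory) ⟶ ⟨L l, hL⟩),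
    IsProjectiveCover p

/-- `X` lies in the full subcategory `P` and is an injective object of that subcategory. -/
def IsInjectiveIn (P : ObjectProperty C) (X : C) : Prop :=
  ∃ h : P X, Injective (⟨X, h⟩ : P.FullSubcategory)

/-- The Yoneda extension group `Ext^n(X, Y)` of `C` vanishes. -/
def ExtVanishes (X Y : C) (n : ℕ) : Prop :=
  letI : HasExt.{max u v} C := HasExt.standard C
  Subsingleton (Abelian.Ext X Y n)

/-- `(C, ≤)` is a lower finite highest weight category. -/
structure IsLowerFiniteHighestWeight (o : PartialOrder Λ) : Prop where
  /-- The partial order is lower finite. -/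
  lowerFinite : ∀ l : Λ, {m | o.le m l}.Finite
  /-- `L l` has an injective hull `∇(l)` in `C_{≤ l}`. -/
  exists_costandard : ∀ l : Λ, ∃ N : C, IsCostandard L o l N
  /-- `L l` has a projective cover `Δ(l)` in `C_{≤ l}`. -/
  exists_standard : ∀ l : Λ, ∃ D : C, IsStandard L o l D
  /-- `[∇(l) : L l] = 1`. -/
  multiplicity_one : ∀ (l : Λ) (N : C), IsCostandard L o l N → HasMultiplicity N (L l) 1
  /-- `∇(l)` is injective in `C_Ω` for every finite ideal `Ω` in which `l` is maximal. -/
  costandard_injective : ∀ (l : Λ) (N : C), IsCostandard L o l N →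
    ∀ Ω : Set Λ, Ω.Finite → IsLowerSet Ω → Maximal (· ∈ Ω) l → IsInjectiveIn (serreSub L Ω) N
  /-- `Ext²(Δ(l), ∇(m)) = 0`. -/
  ext_two : ∀ (l m : Λ) (D N : C), IsStandard L o l D → IsCostandard L o m N → ExtVanishes D N 2

/-- Two highest weight structures on `C` are equivalent if their costandard objects with the
same label are isomorphic. -/
def EquivalentStructures (o₁ o₂ : PartialOrder Λ) : Prop :=
  ∀ (l : Λ) (N₁ N₂ : C), IsCostandard L o₁ l N₁ → IsCostandard L o₂ l N₂ → Nonempty (N₁ ≅ N₂)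

/-- An anti-autoequivalence preserves simples if it sends every simple object to an isomorphic
object. -/
def SimplePreserving (Ψ : Cᵒᵖ ≌ C) : Prop :=
  ∀ S : C, Simple S → Nonempty (Ψ.functor.obj (Opposite.op S) ≅ S)

end

end LFHW

/-! The Euler form `∑ (-1)^n dim Ext^n(X, Y)` depends on the category alone and not on an order on
`Λ`. For a highest weight structure, `Ext^n(Δ(l), ∇(m))` vanishes unless `n = 0` and `l = m`, when
it is one-dimensional. The duality exchanges `∇(l)` and `Δ(l)` and preserves characters, so the
characters of the costandard objects form an orthonormal basis of `ℤ^(Λ)`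
(`eulerPairing_costandard`, `span_intCh_costandard`).

Two orthonormal bases differ by a signed permutation, and nonnegativity of characters excludes the
signs (`exists_eq_of_orthonormal`). Hence `∇₂(l)` has the character of `∇₁(σ l)` for an injective
`σ`. Since `L(σ l)` occurs in `∇₁(σ l)`, it occurs in `∇₂(l)`, so `σ l ≤₂ l`; well-foundedness
forces `σ = id` (`ch_costandard_eq`). Once the characters agree, each of `∇₁(l)`, `∇₂(l)` lies in
the truncation in which the other is an injective hull of `L(l)`, and the two are isomorphic.

The homological work is to pass from `Ext^2(Δ, ∇) = 0` to all higher degrees without enough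
projectives. Call `X` good if `Ext^1(X, ∇(m)) = 0` for all `m` (`ExtOneVanishes`). A nonzero good
object has a standard quotient with good kernel, so `Ext^2` from a good object to any `∇(m)`
vanishes (`ext_two_of_extOneVanishes`). Every object is a quotient of a good one, obtained by
iterated extensions by standard objects (`exists_epi_extOneVanishes`). Effaceability of extension
classes and dimension shifting then give `ext_costandard`, and with it finiteness of all `Ext`
groups (`finiteExt`). -/

namespace LFHW

/-! ### Effaceability of extension classes, and degree one classes as short exact sequences. -/

section ExtTools

universe w

open Abelian DerivedCategory ZeroObject

-- The complex ends in degree `i`, so `K.X i` consists of cycles and surjects onto the homology,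
-- which is `X`; the inclusion of the top term is a chain map for the same reason.
open HomologicalComplex in
lemma exists_epi_single_map_factors {C : Type u} [Category.{v} C] [Abelian C]
    {X : C} {K : CochainComplex C ℤ} {i : ℤ}
    (π : K ⟶ (single C (ComplexShape.up ℤ) i).obj X) [K.IsStrictlyLE i] [QuasiIsoAt π i] :
    ∃ (X' : C) (α : X' ⟶ X) (s : (single C (ComplexShape.up ℤ) i).obj X' ⟶ K),
      Epi α ∧ s ≫ π = (single C (ComplexShape.up ℤ) i).map α := by
  let e := K.iCyclesIso i (i + 1) (by simp)
    ((K.isZero_of_isStrictlyLE i (i + 1) (by simp)).eq_of_tgt _ _)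
  let β := K.homologyπ i ≫ homologyMap π i ≫ (singleObjHomologySelfIso _ _ _).hom
  have hα : π.f i = (e.inv ≫ β) ≫ (singleObjXSelf (ComplexShape.up ℤ) i X).inv := by
    rw [← cancel_epi e.hom, Category.assoc, Iso.hom_inv_id_assoc]
    simp only [β, Category.assoc]
    rw [homologyπ_naturality_assoc, homologyπ_singleObjHomologySelfIso_hom_assoc,
      ← singleObjCyclesSelfIso_inv_iCycles, Iso.hom_inv_id_assoc, cyclesMap_i]
    rfl
  have : Epi β := inferInstance
  let s : (single C (ComplexShape.up ℤ) i).obj (K.X i) ⟶ K :=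
    mkHomFromSingle (𝟙 (K.X i)) (by
      intro k _
      apply (K.isZero_of_isStrictlyLE i k (by simp_all; omega)).eq_of_tgt)
  refine ⟨K.X i, e.inv ≫ β, s, inferInstance, ?_⟩
  apply from_single_hom_ext
  rw [comp_f, hα, mkHomFromSingle_f, single_map_f_self]
  simp

/-- Write the morphism as a roof through a complex `K` ending in degree `i`. After restriction to
the top term of `K` it becomes an honest chain map, which is zero because `L` lives in degrees below
`i`. -/
lemma exists_epi_map_comp_eq_zero {C : Type u} [Category.{v} C] [Abelian C]
    [HasDerivedCategory.{w} C] {X : C} {L : CochainComplex C ℤ} {i : ℤ}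
    (φ : Q.obj ((CochainComplex.singleFunctor C i).obj X) ⟶ Q.obj L)
    (n : ℤ) (hn : n < i) [L.IsStrictlyLE n] :
    ∃ (X' : C) (α : X' ⟶ X), Epi α ∧
      Q.map ((CochainComplex.singleFunctor C i).map α) ≫ φ = 0 := by
  obtain ⟨K, _, π, h, g, rfl⟩ := right_fac_of_isStrictlyLE φ i
  have : QuasiIso π := by rwa [isIso_Q_map_iff_quasiIso] at h
  have hπ : QuasiIsoAt π i := inferInstance
  obtain ⟨X', α, s, hα, hs⟩ : ∃ (X' : C) (α : X' ⟶ X)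
      (s : (CochainComplex.singleFunctor C i).obj X' ⟶ K),
      Epi α ∧ s ≫ π = (CochainComplex.singleFunctor C i).map α :=
    @exists_epi_single_map_factors C _ _ X K i π _ hπ
  have hg : s ≫ g = 0 := by
    apply HomologicalComplex.from_single_hom_ext
    apply (L.isZero_of_isStrictlyLE n i hn).eq_of_tgt
  refine ⟨X', α, hα, ?_⟩
  rw [← hs, Functor.map_comp, Category.assoc, IsIso.hom_inv_id_assoc, ← Functor.map_comp, hg,
    Functor.map_zero]

variable {C : Type u} [Category.{v} C] [Abelian C] [HasExt.{w} C]

/-- Extension classes of positive degree are effaceable. -/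
lemma exists_epi_comp_eq_zero {X Y : C} {n : ℕ} (e : Ext X Y (n + 1)) :
    ∃ (X' : C) (α : X' ⟶ X), Epi α ∧ (Ext.mk₀ α).comp e (zero_add _) = 0 := by
  let := HasDerivedCategory.standard C
  -- A class of degree `n + 1` is a map from `X` in degree `0` to `Y` placed in degree `-(n + 1) <
  -- 0`.
  obtain ⟨X', α, hα, h⟩ := exists_epi_map_comp_eq_zero (X := X)
    (L := (CochainComplex.singleFunctor C (-(n + 1))).obj Y)
    (e.hom ≫ ((singleFunctors C).shiftIso (n + 1) (-(n + 1)) 0 (by lia)).hom.app _)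
    (-(n + 1)) (by lia)
  refine ⟨X', α, hα, ?_⟩
  ext
  rw [← Ext.singleFunctor_map_comp_hom, Ext.zero_hom]
  rw [← cancel_mono (((singleFunctors C).shiftIso (n + 1) (-(n + 1)) 0
    (by lia)).hom.app _), zero_comp]
  rw [Category.assoc]
  exact h

/-- Every class of degree one is the class of a short exact sequence. -/
lemma exists_extClass_eq {X Y : C} (e : Ext X Y 1) :
    ∃ (E : C) (i : Y ⟶ E) (p : E ⟶ X) (w : i ≫ p = 0)
      (hS : (ShortComplex.mk i p w).ShortExact), hS.extClass = e := by
  -- Once `α` effaces `e`, the class comes from a map `ker α ⟶ Y`, and the extension sought is the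
  -- pushout of `0 → ker α → X' → X → 0` along that map.
  obtain ⟨X', α, hα, h⟩ := exists_epi_comp_eq_zero (n := 0) e
  let S := ShortComplex.mk (kernel.ι α) α (kernel.condition α)
  have hS : S.ShortExact := { exact := ShortComplex.exact_kernel α }
  obtain ⟨f, hf⟩ := Ext.contravariant_sequence_exact₃ hS Y e h (n₀ := 0) rfl
  obtain ⟨f, rfl⟩ := Ext.homEquiv₀.symm.surjective f
  let q : pushout S.f f ⟶ X := pushout.desc α 0 (by simp [S])
  have w : pushout.inr S.f f ≫ q = 0 := pushout.inr_desc _ _ _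
  have hq : pushout.inl S.f f ≫ q = α := pushout.inl_desc _ _ _
  have : Epi q := by
    have : Epi (pushout.inl S.f f ≫ q) := by rw [hq]; exact hα
    exact epi_of_epi (pushout.inl S.f f) q
  have hS' : (ShortComplex.mk (pushout.inr S.f f) q w).ShortExact :=
    { exact := by
        refine ShortComplex.exact_of_g_is_cokernel _ (CokernelCofork.IsColimit.ofπ' _ _ ?_)
        intro A k hk
        have h1 : kernel.ι α ≫ pushout.inl S.f f ≫ k = 0 := by
          have := pushout.condition (f := S.f) (g := f)
          change S.f ≫ _ = _
          rw [reassoc_of% this, hk, comp_zero]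
        refine ⟨Abelian.epiDesc α (pushout.inl S.f f ≫ k) h1, ?_⟩
        apply pushout.hom_ext
        · rw [reassoc_of% hq, Abelian.comp_epiDesc]
        · rw [reassoc_of% w, zero_comp, hk]
      mono_f := by
        have : Mono S.f := hS.mono_f
        dsimp; infer_instance }
  refine ⟨_, _, _, _, hS', ?_⟩
  let m : S ⟶ ShortComplex.mk (pushout.inr S.f f) q w :=
    { τ₁ := f
      τ₂ := pushout.inl S.f f
      τ₃ := 𝟙 X
      comm₁₂ := pushout.condition.symm
      comm₂₃ := by simp [hq, S] }
  have := ShortComplex.ShortExact.extClass_naturality hS hS' m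
  rw [← hf]
  rw [Ext.mk₀_id_comp] at this
  exact this.symm

end ExtTools
-- Vanishing of `Ext` along long exact sequences.
section ExtVanishing

universe w

open Abelian

variable {C : Type u} [Category.{v} C] [Abelian C] [HasExt.{w} C]

lemma ext_eq_zero_of_isZero_left {X Y : C} (hX : IsZero X) {n : ℕ} (x : Ext X Y n) : x = 0 := by
  have h : Ext.mk₀ (𝟙 X) = 0 := by rw [hX.eq_of_src (𝟙 X) 0, Ext.mk₀_zero]
  rw [← Ext.mk₀_id_comp x, h, Ext.zero_comp]

lemma ext_eq_zero_of_isZero_right {X Y : C} (hY : IsZero Y) {n : ℕ} (x : Ext X Y n) : x = 0 := by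
  have h : Ext.mk₀ (𝟙 Y) = 0 := by rw [hY.eq_of_src (𝟙 Y) 0, Ext.mk₀_zero]
  rw [← Ext.comp_mk₀_id x, h, Ext.comp_zero]

variable {S : ShortComplex C} (hS : S.ShortExact)

include hS

lemma subsingleton_ext_X₂_right (X : C) (n : ℕ) (h₁ : Subsingleton (Ext X S.X₁ n))
    (h₃ : Subsingleton (Ext X S.X₃ n)) : Subsingleton (Ext X S.X₂ n) := by
  refine subsingleton_of_forall_eq 0 fun x => ?_
  obtain ⟨y, rfl⟩ := Ext.covariant_sequence_exact₂ X hS x (Subsingleton.elim _ _)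
  rw [Subsingleton.elim y 0, Ext.zero_comp]

lemma subsingleton_ext_X₃_right (X : C) (n : ℕ) (h₂ : Subsingleton (Ext X S.X₂ n))
    (h₁ : Subsingleton (Ext X S.X₁ (n + 1))) : Subsingleton (Ext X S.X₃ n) := by
  refine subsingleton_of_forall_eq 0 fun x => ?_
  obtain ⟨y, rfl⟩ := Ext.covariant_sequence_exact₃ X hS x rfl (Subsingleton.elim _ _)
  rw [Subsingleton.elim y 0, Ext.zero_comp]

lemma subsingleton_ext_X₁_right (X : C) (n : ℕ) (h₂ : Subsingleton (Ext X S.X₂ (n + 1)))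
    (h₃ : Subsingleton (Ext X S.X₃ n)) : Subsingleton (Ext X S.X₁ (n + 1)) := by
  refine subsingleton_of_forall_eq 0 fun x => ?_
  obtain ⟨y, rfl⟩ := Ext.covariant_sequence_exact₁ X hS x (Subsingleton.elim _ _) rfl
  rw [Subsingleton.elim y 0, Ext.zero_comp]

lemma subsingleton_ext_X₂_left (Y : C) (n : ℕ) (h₁ : Subsingleton (Ext S.X₁ Y n))
    (h₃ : Subsingleton (Ext S.X₃ Y n)) : Subsingleton (Ext S.X₂ Y n) := by
  refine subsingleton_of_forall_eq 0 fun x => ?_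
  obtain ⟨y, rfl⟩ := Ext.contravariant_sequence_exact₂ hS Y x (Subsingleton.elim _ _)
  rw [Subsingleton.elim y 0, Ext.comp_zero]

lemma subsingleton_ext_X₁_left (Y : C) (n : ℕ) (h₂ : Subsingleton (Ext S.X₂ Y n))
    (h₃ : Subsingleton (Ext S.X₃ Y (n + 1))) : Subsingleton (Ext S.X₁ Y n) := by
  refine subsingleton_of_forall_eq 0 fun x => ?_
  obtain ⟨y, rfl⟩ := Ext.contravariant_sequence_exact₁ hS Y x (n₁ := n + 1) (add_comm 1 n)
    (Subsingleton.elim _ _)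
  rw [Subsingleton.elim y 0, Ext.comp_zero]

lemma subsingleton_ext_X₃_left (Y : C) (n : ℕ) (h₂ : Subsingleton (Ext S.X₂ Y (n + 1)))
    (h₁ : Subsingleton (Ext S.X₁ Y n)) : Subsingleton (Ext S.X₃ Y (n + 1)) := by
  refine subsingleton_of_forall_eq 0 fun x => ?_
  obtain ⟨y, rfl⟩ := Ext.contravariant_sequence_exact₃ hS Y x (Subsingleton.elim _ _)
    (add_comm 1 n)
  rw [Subsingleton.elim y 0, Ext.comp_zero]

end ExtVanishing

/-! ### Alternating sums of dimensions and additivity of the Euler form. -/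

section AlternatingSum

lemma finite_of_exact {k : Type*} [Field k] {U V W : Type*} [AddCommGroup U] [Module k U]
    [AddCommGroup V] [Module k V] [AddCommGroup W] [Module k W] (f : U →ₗ[k] V) (g : V →ₗ[k] W)
    (h : Function.Exact f g) [Module.Finite k U] [Module.Finite k W] : Module.Finite k V := by
  rw [Module.finite_def]
  refine Submodule.fg_of_fg_map_of_fg_inf_ker g (IsNoetherian.noetherian _) ?_
  rw [top_inf_eq, LinearMap.exact_iff.mp h, LinearMap.range_eq_map]
  exact (Module.Finite.fg_top (R := k) (M := U)).map f

/-- The alternating sum of the dimensions in a bounded long exact sequence vanishes. -/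
lemma sum_alternating_finrank_of_exact {k : Type*} [Field k] {U V W : ℕ → Type*}
    [∀ n, AddCommGroup (U n)] [∀ n, Module k (U n)] [∀ n, AddCommGroup (V n)]
    [∀ n, Module k (V n)] [∀ n, AddCommGroup (W n)] [∀ n, Module k (W n)]
    [∀ n, Module.Finite k (U n)] [∀ n, Module.Finite k (V n)] [∀ n, Module.Finite k (W n)]
    (f : ∀ n, U n →ₗ[k] V n) (g : ∀ n, V n →ₗ[k] W n) (d : ∀ n, W n →ₗ[k] U (n + 1))
    (hf : Function.Injective (f 0)) (hfg : ∀ n, Function.Exact (f n) (g n))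
    (hgd : ∀ n, Function.Exact (g n) (d n)) (hdf : ∀ n, Function.Exact (d n) (f (n + 1)))
    (N : ℕ) (hN : Subsingleton (U N)) :
    ∑ n ∈ Finset.range N, (-1 : ℤ) ^ n * Module.finrank k (V n) =
      ∑ n ∈ Finset.range N, (-1 : ℤ) ^ n * Module.finrank k (U n) +
        ∑ n ∈ Finset.range N, (-1 : ℤ) ^ n * Module.finrank k (W n) := by
  -- The truncated sum has the error term `± dim ker (f m)`. It is zero at the start by injectivity
  -- of `f 0`, and at `N` because `U N = 0`.
  have key : ∀ m, ∑ n ∈ Finset.range m, (-1 : ℤ) ^ n * Module.finrank k (V n) =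
      ∑ n ∈ Finset.range m, (-1 : ℤ) ^ n * Module.finrank k (U n) +
        ∑ n ∈ Finset.range m, (-1 : ℤ) ^ n * Module.finrank k (W n) +
        (-1 : ℤ) ^ m * Module.finrank k (LinearMap.ker (f m)) := by
    intro m
    induction m with
    | zero =>
      have : Module.finrank k (LinearMap.ker (f 0)) = 0 := by
        rw [LinearMap.ker_eq_bot.mpr hf]
        exact finrank_bot k _
      simp [this]
    | succ m ih =>
      simp only [Finset.sum_range_succ, ih]
      have h₁ := LinearMap.finrank_range_add_finrank_ker (f m)
      have h₂ := LinearMap.finrank_range_add_finrank_ker (g m)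
      have h₃ := LinearMap.finrank_range_add_finrank_ker (d m)
      rw [LinearMap.exact_iff.mp (hfg m)] at h₂
      rw [LinearMap.exact_iff.mp (hgd m)] at h₃
      rw [LinearMap.exact_iff.mp (hdf m)]
      rw [← h₁, ← h₂, ← h₃]
      push_cast
      ring
  rw [key N]
  have : Module.finrank k (LinearMap.ker (f N)) = 0 := Module.finrank_zero_of_subsingleton
  simp [this]

end AlternatingSum

section EulerForm

universe w

open Abelian

variable (k : Type t) [Field k] {C : Type u} [Category.{v} C] [Abelian C] [Linear k C]
  [HasExt.{w} C]

/-- All extension groups are finite dimensional, and only finitely many of them do not vanish. -/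
structure FiniteExt (X Y : C) : Prop where
  finite : ∀ n, Module.Finite k (Ext X Y n)
  bounded : ∃ N, ∀ n, N ≤ n → Subsingleton (Ext X Y n)

/-- The Euler form `∑ (-1) ^ n * dim Ext^n(X, Y)`. -/
noncomputable def eulerForm (X Y : C) : ℤ :=
  ∑ᶠ n : ℕ, (-1 : ℤ) ^ n * Module.finrank k (Ext X Y n)

variable {k}

lemma eulerForm_eq_sum {X Y : C} {N : ℕ} (h : ∀ n, N ≤ n → Subsingleton (Ext X Y n)) :
    eulerForm k X Y = ∑ n ∈ Finset.range N, (-1 : ℤ) ^ n * Module.finrank k (Ext X Y n) := by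
  refine finsum_eq_sum_of_support_subset _ fun n hn => ?_
  by_contra hlt
  have := h n (by simpa using hlt)
  simp only [ne_eq, Function.mem_support, Module.finrank_zero_of_subsingleton] at hn
  simp at hn

variable {S : ShortComplex C} (hS : S.ShortExact)

section

variable (k)

include hS

lemma finite_ext_X₂_right (X : C) (n : ℕ) [Module.Finite k (Ext X S.X₁ n)]
    [Module.Finite k (Ext X S.X₃ n)] : Module.Finite k (Ext X S.X₂ n) :=
  finite_of_exact ((Ext.mk₀ S.f).postcompOfLinear k X (add_zero n))
    ((Ext.mk₀ S.g).postcompOfLinear k X (add_zero n))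
    ((ShortComplex.ab_exact_iff_function_exact _).mp (Ext.covariant_sequence_exact₂' X hS n))

lemma finite_ext_X₁_right (X : C) (n : ℕ) [Module.Finite k (Ext X S.X₃ n)]
    [Module.Finite k (Ext X S.X₂ (n + 1))] : Module.Finite k (Ext X S.X₁ (n + 1)) :=
  finite_of_exact (hS.extClass.postcompOfLinear k X rfl)
    ((Ext.mk₀ S.f).postcompOfLinear k X (add_zero (n + 1)))
    ((ShortComplex.ab_exact_iff_function_exact _).mp
      (Ext.covariant_sequence_exact₁' X hS n (n + 1) rfl))

end

lemma eulerForm_right (hS : S.ShortExact) (X : C) (h₁ : FiniteExt k X S.X₁)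
    (h₂ : FiniteExt k X S.X₂) (h₃ : FiniteExt k X S.X₃) :
    eulerForm k X S.X₂ = eulerForm k X S.X₁ + eulerForm k X S.X₃ := by
  obtain ⟨N₁, hN₁⟩ := h₁.bounded
  obtain ⟨N₂, hN₂⟩ := h₂.bounded
  obtain ⟨N₃, hN₃⟩ := h₃.bounded
  let N := N₁ + N₂ + N₃
  have := h₁.finite
  have := h₂.finite
  have := h₃.finite
  rw [eulerForm_eq_sum (N := N) fun n hn => hN₁ n (by omega),
    eulerForm_eq_sum (N := N) fun n hn => hN₂ n (by omega),
    eulerForm_eq_sum (N := N) fun n hn => hN₃ n (by omega)]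
  refine sum_alternating_finrank_of_exact
    (fun n => (Ext.mk₀ S.f).postcompOfLinear k X (add_zero n))
    (fun n => (Ext.mk₀ S.g).postcompOfLinear k X (add_zero n))
    (fun n => hS.extClass.postcompOfLinear k X rfl) ?_
    (fun n => (ShortComplex.ab_exact_iff_function_exact _).mp
      (Ext.covariant_sequence_exact₂' X hS n))
    (fun n => (ShortComplex.ab_exact_iff_function_exact _).mp
      (Ext.covariant_sequence_exact₃' X hS n (n + 1) rfl))
    (fun n => (ShortComplex.ab_exact_iff_function_exact _).mp
      (Ext.covariant_sequence_exact₁' X hS n (n + 1) rfl)) N (hN₁ _ (by omega))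
  have := hS.mono_f
  exact Ext.postcomp_mk₀_injective_of_mono X S.f

lemma eulerForm_left (hS : S.ShortExact) (Y : C) (h₁ : FiniteExt k S.X₁ Y)
    (h₂ : FiniteExt k S.X₂ Y) (h₃ : FiniteExt k S.X₃ Y) :
    eulerForm k S.X₂ Y = eulerForm k S.X₁ Y + eulerForm k S.X₃ Y := by
  obtain ⟨N₁, hN₁⟩ := h₁.bounded
  obtain ⟨N₂, hN₂⟩ := h₂.bounded
  obtain ⟨N₃, hN₃⟩ := h₃.bounded
  let N := N₁ + N₂ + N₃
  have := h₁.finite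
  have := h₂.finite
  have := h₃.finite
  rw [eulerForm_eq_sum (N := N) fun n hn => hN₁ n (by omega),
    eulerForm_eq_sum (N := N) fun n hn => hN₂ n (by omega),
    eulerForm_eq_sum (N := N) fun n hn => hN₃ n (by omega), add_comm]
  -- Contravariance reverses the sequence: `S.X₃` comes first, which is why the sum was commuted.
  refine sum_alternating_finrank_of_exact
    (fun n => (Ext.mk₀ S.g).precompOfLinear k Y (zero_add n))
    (fun n => (Ext.mk₀ S.f).precompOfLinear k Y (zero_add n))
    (fun n => hS.extClass.precompOfLinear k Y (add_comm 1 n)) ?_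
    (fun n => (ShortComplex.ab_exact_iff_function_exact _).mp
      (Ext.contravariant_sequence_exact₂' hS Y n))
    (fun n => (ShortComplex.ab_exact_iff_function_exact _).mp
      (Ext.contravariant_sequence_exact₁' hS Y n (n + 1) (add_comm 1 n)))
    (fun n => (ShortComplex.ab_exact_iff_function_exact _).mp
      (Ext.contravariant_sequence_exact₃' hS Y n (n + 1) (add_comm 1 n))) N (hN₃ _ (by omega))
  have := hS.epi_g
  exact Ext.precomp_mk₀_injective_of_epi Y S.g

end EulerForm
-- Short exact sequences: lifts, pullbacks, transport along isomorphisms.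
section ShortExactTools

variable {C : Type u} [Category.{v} C] [Abelian C]

lemma shortExact_of_lift {X Y Z : C} (i : X ⟶ Y) (p : Y ⟶ Z) (w : i ≫ p = 0) [Mono i] [Epi p]
    (h : ∀ (A : C) (f : A ⟶ Y), f ≫ p = 0 → ∃ g : A ⟶ X, g ≫ i = f) :
    (ShortComplex.mk i p w).ShortExact where
  exact := ShortComplex.exact_of_f_is_kernel _
    (KernelFork.IsLimit.ofι' i w fun f hf => ⟨(h _ f hf).choose, (h _ f hf).choose_spec⟩)

lemma shortExact_kernel {X Y : C} (p : X ⟶ Y) [Epi p] :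
    (ShortComplex.mk (kernel.ι p) p (kernel.condition p)).ShortExact where
  exact := ShortComplex.exact_kernel p

lemma shortExact_cokernel {X Y : C} (i : X ⟶ Y) [Mono i] :
    (ShortComplex.mk i (cokernel.π i) (cokernel.condition i)).ShortExact where
  exact := ShortComplex.exact_cokernel i

lemma exists_lift_of_shortExact {X Y Z : C} {i : X ⟶ Y} {p : Y ⟶ Z} {w : i ≫ p = 0}
    (hS : (ShortComplex.mk i p w).ShortExact) {A : C} (f : A ⟶ Y) (hf : f ≫ p = 0) :
    ∃ g : A ⟶ X, g ≫ i = f :=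
  ⟨hS.fIsKernel.lift (KernelFork.ofι f hf), hS.fIsKernel.fac _ WalkingParallelPair.zero⟩

lemma exists_desc_of_shortExact {X Y Z : C} {i : X ⟶ Y} {p : Y ⟶ Z} {w : i ≫ p = 0}
    (hS : (ShortComplex.mk i p w).ShortExact) {A : C} (f : Y ⟶ A) (hf : i ≫ f = 0) :
    ∃ g : Z ⟶ A, p ≫ g = f :=
  ⟨hS.gIsCokernel.desc (CokernelCofork.ofπ f hf), hS.gIsCokernel.fac _ WalkingParallelPair.one⟩

lemma shortExact_of_iso_middle {X Y Z Y' : C} {i : X ⟶ Y} {p : Y ⟶ Z} {w : i ≫ p = 0}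
    (hS : (ShortComplex.mk i p w).ShortExact) (e : Y ≅ Y') :
    (ShortComplex.mk (i ≫ e.hom) (e.inv ≫ p) (by simp [w])).ShortExact :=
  ShortComplex.shortExact_of_iso (S₁ := ShortComplex.mk i p w)
    (ShortComplex.isoMk (Iso.refl _) e (Iso.refl _) (by simp) (by simp)) hS

lemma shortExact_of_iso_right {X Y Z Z' : C} {i : X ⟶ Y} {p : Y ⟶ Z} {w : i ≫ p = 0}
    (hS : (ShortComplex.mk i p w).ShortExact) (e : Z ≅ Z') :
    (ShortComplex.mk i (p ≫ e.hom) (by rw [reassoc_of% w, zero_comp])).ShortExact :=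
  ShortComplex.shortExact_of_iso (S₁ := ShortComplex.mk i p w)
    (ShortComplex.isoMk (Iso.refl _) (Iso.refl _) e (by simp) (by simp)) hS

lemma shortExact_pullback {X Y Z A : C} {i : X ⟶ Y} {p : Y ⟶ Z} {w : i ≫ p = 0}
    (hS : (ShortComplex.mk i p w).ShortExact) (a : A ⟶ Z) :
    (ShortComplex.mk (pullback.lift i 0 (by simp [w]) : X ⟶ pullback p a) (pullback.snd p a)
      (pullback.lift_snd _ _ _)).ShortExact := by
  have : Epi p := hS.epi_g
  have : Mono i := hS.mono_f
  have hl : pullback.lift i 0 (by simp [w]) ≫ pullback.fst p a = i := pullback.lift_fst _ _ _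
  have : Mono (pullback.lift i 0 (by simp [w]) : X ⟶ pullback p a) := mono_of_mono_fac hl
  refine shortExact_of_lift _ _ _ fun B f hf => ?_
  obtain ⟨g, hg⟩ := exists_lift_of_shortExact hS (f ≫ pullback.fst p a)
    (by rw [Category.assoc, pullback.condition, reassoc_of% hf, zero_comp])
  refine ⟨g, pullback.hom_ext ?_ ?_⟩
  · rw [Category.assoc, pullback.lift_fst, hg]
  · rw [Category.assoc, pullback.lift_snd, hf, comp_zero]

lemma shortExact_pullback_fst {X Y Z A : C} {i : X ⟶ Y} {p : Y ⟶ Z} {w : i ≫ p = 0}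
    (hS : (ShortComplex.mk i p w).ShortExact) (q : A ⟶ Y) [Epi q] :
    (ShortComplex.mk (pullback.fst q i) (q ≫ p)
      (by rw [pullback.condition_assoc, w, comp_zero])).ShortExact := by
  have : Epi p := hS.epi_g
  have : Mono i := hS.mono_f
  refine shortExact_of_lift _ _ _ fun B f hf => ?_
  obtain ⟨g, hg⟩ := exists_lift_of_shortExact hS (f ≫ q) (by rw [Category.assoc, hf])
  exact ⟨pullback.lift f g hg.symm, pullback.lift_fst _ _ _⟩

lemma isIso_of_shortExact_of_isZero_right {X Y Z : C} {i : X ⟶ Y} {p : Y ⟶ Z} {w : i ≫ p = 0}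
    (hS : (ShortComplex.mk i p w).ShortExact) (hZ : IsZero Z) : IsIso i := by
  have : Mono i := hS.mono_f
  have : Epi i := hS.exact.epi_f (hZ.eq_of_tgt _ _)
  exact isIso_of_mono_of_epi i

lemma isIso_of_shortExact_of_isZero_left {X Y Z : C} {i : X ⟶ Y} {p : Y ⟶ Z} {w : i ≫ p = 0}
    (hS : (ShortComplex.mk i p w).ShortExact) (hX : IsZero X) : IsIso p := by
  have : Epi p := hS.epi_g
  have : Mono p := hS.exact.mono_g (hX.eq_of_src _ _)
  exact isIso_of_mono_of_epi p

end ShortExactTools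

/-! ### Induction on length and the Jordan–Hölder theorem. -/

section FiniteLength

variable {C : Type u} [Category.{v} C] [Abelian C] [∀ X : C, IsNoetherianObject X]
  [∀ X : C, IsArtinianObject X]

/-- Take a maximal subobject `A` with the property. If `A` is proper, the artinian quotient `X / A`
has a simple subobject, whose preimage in `X` is a larger one. -/
theorem finite_length_induction {P : C → Prop} (zero : ∀ X, IsZero X → P X)
    (step : ∀ {A X T : C} (i : A ⟶ X) (p : X ⟶ T) (w : i ≫ p = 0),
      (ShortComplex.mk i p w).ShortExact → Simple T → P A → P X) (X : C) : P X := by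
  have iso : ∀ {Y Z : C}, (∀ W, Nonempty (Y ≅ W) → P W) → (Y ≅ Z) → ∀ W, Nonempty (Z ≅ W) → P W :=
    fun h e W ⟨f⟩ => h W ⟨e ≪≫ f⟩
  -- `P` is not assumed invariant under isomorphism, so it is required on whole isomorphism classes.
  let s : Set (Subobject X) := {A | ∀ W, Nonempty ((A : C) ≅ W) → P W}
  have hs : s.Nonempty := ⟨⊥, fun W ⟨e⟩ => zero W ((isZero_zero C).of_iso
    (e.symm ≪≫ Subobject.botCoeIsoZero))⟩
  obtain ⟨A, hA, hmax⟩ := (wellFounded_gt (α := Subobject X)).has_min s hs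
  suffices h : A = ⊤ by
    subst h
    exact hA X ⟨asIso (⊤ : Subobject X).arrow⟩
  by_contra hne
  have hQ : ¬ IsZero (cokernel A.arrow) := fun h => hne <| by
    have := isIso_of_shortExact_of_isZero_right (shortExact_cokernel A.arrow) h
    exact Subobject.eq_top_of_isIso_arrow A
  let a := simpleSubobjectArrow hQ
  have hSE := shortExact_pullback (shortExact_cokernel A.arrow) a
  let B : Subobject X := Subobject.mk (pullback.fst (cokernel.π A.arrow) a)
  have hB : B ∈ s := by
    refine iso (Y := pullback (cokernel.π A.arrow) a) (fun W ⟨e⟩ => ?_)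
      (Subobject.underlyingIso _).symm
    exact step _ _ _ (shortExact_of_iso_middle hSE e) inferInstance (hA _ ⟨Iso.refl _⟩)
  refine hmax B hB (lt_of_le_of_ne ?_ ?_)
  · exact Subobject.le_mk_of_comm (pullback.lift A.arrow 0 (by simp)) (pullback.lift_fst _ _ _)
  · intro hAB
    have hf : pullback.fst (cokernel.π A.arrow) a ≫ cokernel.π A.arrow = 0 := by
      have : (pullback.fst (cokernel.π A.arrow) a) =
          (Subobject.ofMkLE _ A hAB.ge) ≫ A.arrow := (Subobject.ofMkLE_arrow _).symm
      rw [this, Category.assoc, cokernel.condition, comp_zero]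
    have h0 : pullback.snd (cokernel.π A.arrow) a = 0 := by
      rw [← cancel_mono a, ← pullback.condition, hf, zero_comp]
    have : Epi (pullback.snd (cokernel.π A.arrow) a) := hSE.epi_g
    exact Simple.not_isZero (simpleSubobject hQ) (IsZero.of_epi_eq_zero _ h0)

end FiniteLength

section Character

variable {C : Type u} [Category.{v} C] [Abelian C] {Λ : Type t}

/-- `X` has a composition series whose factors are counted by `c`. -/
inductive HasChar (L : Λ → C) : C → (Λ →₀ ℕ) → Prop
  | zero {X : C} (hX : IsZero X) : HasChar L X 0
  | step {A X : C} {l : Λ} (i : A ⟶ X) (p : X ⟶ L l) (w : i ≫ p = 0)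
      (hS : (ShortComplex.mk i p w).ShortExact) {c : Λ →₀ ℕ} (h : HasChar L A c) :
      HasChar L X (c + Finsupp.single l 1)

variable {L : Λ → C}

lemma HasChar.of_iso {X Y : C} (e : X ≅ Y) {c : Λ →₀ ℕ} (h : HasChar L X c) : HasChar L Y c := by
  cases h with
  | zero hX => exact .zero (hX.of_iso e.symm)
  | step i p w hS h => exact .step _ _ _ (shortExact_of_iso_middle hS e) h

lemma HasChar.exists [∀ X : C, IsNoetherianObject X] [∀ X : C, IsArtinianObject X]
    (hL : IsSimpleLabelling L) (X : C) : ∃ c, HasChar L X c := by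
  induction X using finite_length_induction with
  | zero X hX => exact ⟨0, .zero hX⟩
  | step i p w hS hT h =>
    obtain ⟨c, hc⟩ := h
    obtain ⟨l, ⟨e⟩⟩ := hL.exhaustive _ hT
    exact ⟨_, .step _ _ _ (shortExact_of_iso_right hS e) hc⟩

/-- Compare the last steps `A` and `B` of two series. If `B` is contained in `A`, they coincide and
induction applies; otherwise `A ∩ B` has simple quotient `L m` in `A` and `L l` in `B`, and a series
through `A ∩ B` links the two. -/
lemma HasChar.unique [∀ X : C, IsNoetherianObject X] [∀ X : C, IsArtinianObject X]
    (hL : IsSimpleLabelling L) {X : C} {c c' : Λ →₀ ℕ} (h : HasChar L X c)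
    (h' : HasChar L X c') : c = c' := by
  induction hn : c.degree using Nat.strong_induction_on generalizing X c c' with
  | _ n ih =>
  have := hL.simple
  subst hn
  cases h with
  | zero hX =>
    cases h' with
    | zero _ => rfl
    | step i p w hS h =>
      exact (Simple.not_isZero (L _) (@IsZero.of_epi_eq_zero _ _ _ _ _ p hS.epi_g
        (hX.eq_of_src _ _))).elim
  | @step A _ l i p w hS c₁ h =>
    have hp : Epi p := hS.epi_g
    have hp0 : p ≠ 0 := fun h0 => Simple.not_isZero (L _) (IsZero.of_epi_eq_zero p h0)
    cases h' with
    | zero hX => exact (hp0 (hX.eq_of_src _ _)).elim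
    | @step B _ m j q w' hS' c₂ h' =>
      have hq : Epi q := hS'.epi_g
      have hq0 : q ≠ 0 := fun h0 => Simple.not_isZero (L _) (IsZero.of_epi_eq_zero q h0)
      have hdeg : c₁.degree < (c₁ + Finsupp.single l 1).degree := by simp
      have hi : Mono i := hS.mono_f
      have hj : Mono j := hS'.mono_f
      by_cases h0 : j ≫ p = 0
      · obtain ⟨r, hr⟩ := exists_desc_of_shortExact hS' p h0
        have hr0 : r ≠ 0 := by
          rintro rfl
          exact hp0 (by rw [← hr, comp_zero])
        have : IsIso r := isIso_of_hom_simple hr0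
        obtain rfl : m = l := hL.injective _ _ ⟨asIso r⟩
        have h1 : i ≫ q = 0 := by
          rw [← cancel_mono r, Category.assoc, hr, w, zero_comp]
        obtain ⟨f, hf⟩ := exists_lift_of_shortExact hS' i h1
        obtain ⟨g, hg⟩ := exists_lift_of_shortExact hS j h0
        have e : B ≅ A := ⟨g, f, by rw [← cancel_mono j]; simp [hf, hg],
          by rw [← cancel_mono i]; simp [hf, hg]⟩
        rw [ih _ hdeg h (h'.of_iso e) rfl]
      · have : Epi (j ≫ p) := epi_of_nonzero_to_simple h0
        -- `kernel (j ≫ p)` is the intersection of `A` and `B`.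
        obtain ⟨d, hd⟩ := HasChar.exists hL (kernel (j ≫ p))
        have hB : HasChar L B (d + Finsupp.single l 1) := .step _ _ _ (shortExact_kernel (j ≫ p)) hd
        have hA : HasChar L A (d + Finsupp.single m 1) := by
          obtain ⟨f, hf⟩ := exists_lift_of_shortExact hS (kernel.ι (j ≫ p) ≫ j)
            (by rw [Category.assoc, kernel.condition])
          have hfm : Mono f := mono_of_mono_fac hf
          have hiq : i ≫ q ≠ 0 := by
            intro h1
            obtain ⟨r, hr⟩ := exists_desc_of_shortExact hS q h1
            have hr0 : r ≠ 0 := by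
              rintro rfl
              exact hq0 (by rw [← hr, comp_zero])
            have : IsIso r := isIso_of_hom_simple hr0
            exact h0 (by rw [← cancel_mono r, Category.assoc, hr, w', zero_comp])
          have : Epi (i ≫ q) := epi_of_nonzero_to_simple hiq
          refine .step f (i ≫ q) (by rw [reassoc_of% hf, w', comp_zero]) ?_ hd
          refine shortExact_of_lift _ _ _ fun Z a ha => ?_
          obtain ⟨b, hb⟩ := exists_lift_of_shortExact hS' (a ≫ i) (by rw [Category.assoc, ha])
          refine ⟨kernel.lift (j ≫ p) b (by rw [reassoc_of% hb, w, comp_zero]), ?_⟩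
          rw [← cancel_mono i, Category.assoc, hf, kernel.lift_ι_assoc, hb]
        have e₁ := ih _ hdeg h hA rfl
        -- Induction applies to `B` too, as this character has the same degree as that of `A`.
        have e₂ := ih (d + Finsupp.single l 1).degree
          (by rw [e₁]; simp) hB h' rfl
        rw [e₁, ← e₂]
        abel

variable (L) in
/-- The character of `X`: the multiplicities of the `L l` in a composition series. -/
noncomputable def ch (X : C) : Λ →₀ ℕ :=
  open Classical in if h : ∃ c, HasChar L X c then h.choose else 0

variable [∀ X : C, IsNoetherianObject X] [∀ X : C, IsArtinianObject X] (hL : IsSimpleLabelling L)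

include hL

lemma hasChar_ch (X : C) : HasChar L X (ch L X) := by
  rw [ch, dif_pos (HasChar.exists hL X)]
  exact (HasChar.exists hL X).choose_spec

lemma HasChar.ch_eq {X : C} {c : Λ →₀ ℕ} (h : HasChar L X c) : ch L X = c :=
  (hasChar_ch hL X).unique hL h

lemma ch_of_iso {X Y : C} (e : X ≅ Y) : ch L X = ch L Y :=
  ((hasChar_ch hL Y).of_iso e.symm).ch_eq hL

lemma ch_of_isZero {X : C} (hX : IsZero X) : ch L X = 0 :=
  (HasChar.zero hX).ch_eq hL

lemma isZero_of_ch_eq_zero {X : C} (h : ch L X = 0) : IsZero X := by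
  have hX := hasChar_ch hL X
  rw [h] at hX
  generalize hc : (0 : Λ →₀ ℕ) = c at hX
  cases hX with
  | zero hX => exact hX
  | step i p w hS h => simpa using congrArg Finsupp.degree hc

open ZeroObject in
lemma ch_simple (l : Λ) : ch L (L l) = Finsupp.single l 1 := by
  have : HasChar L (L l) (0 + Finsupp.single l 1) := .step (0 : 0 ⟶ L l) (𝟙 _) (by simp)
    (shortExact_of_lift _ _ _ fun A f hf => ⟨0, by simpa using hf.symm⟩) (.zero (isZero_zero C))
  simpa using this.ch_eq hL

lemma ch_of_shortExact {X Y Z : C} {i : X ⟶ Y} {p : Y ⟶ Z} {w : i ≫ p = 0}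
    (hS : (ShortComplex.mk i p w).ShortExact) : ch L Y = ch L X + ch L Z := by
  induction Z using finite_length_induction generalizing X Y with
  | zero Z hZ =>
    have := isIso_of_shortExact_of_isZero_right hS hZ
    rw [ch_of_isZero hL hZ, add_zero, ch_of_iso hL (asIso i)]
  | @step A Z T a q w' hS' hT ih =>
    obtain ⟨l, ⟨e⟩⟩ := hL.exhaustive _ hT
    have hp : Epi p := hS.epi_g
    have h₁ := ih (shortExact_pullback hS a)
    have h₂ := (HasChar.step _ _ _ (shortExact_of_iso_right (shortExact_pullback_fst hS' p) e)
      (hasChar_ch hL _)).ch_eq hL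
    have h₃ := (HasChar.step _ _ _ (shortExact_of_iso_right hS' e) (hasChar_ch hL _)).ch_eq hL
    rw [h₂, h₃, h₁, add_assoc]

lemma ch_eq_add (S : ShortComplex C) (hS : S.ShortExact) :
    ch L S.X₂ = ch L S.X₁ + ch L S.X₃ :=
  ch_of_shortExact hL hS

end Character
-- Serre subcategories described by composition factors.
section FactorsIn

variable {C : Type u} [Category.{v} C] [Abelian C] {Λ : Type t} {L : Λ → C}

variable (L) in
/-- All composition factors of `X` are of the form `L l` with `l ∈ Ω`. -/
def FactorsIn (Ω : Set Λ) : ObjectProperty C := fun X => ∀ l, ch L X l ≠ 0 → l ∈ Ω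

lemma factorsIn_univ (X : C) : FactorsIn L Set.univ X := fun _ _ => trivial

lemma FactorsIn.mono {Ω Ω' : Set Λ} {X : C} (h : FactorsIn L Ω X) (hΩ : Ω ⊆ Ω') :
    FactorsIn L Ω' X := fun l hl => hΩ (h l hl)

variable [∀ X : C, IsNoetherianObject X] [∀ X : C, IsArtinianObject X]

lemma ch_le_of_mono (hL : IsSimpleLabelling L) {X Y : C} (f : X ⟶ Y) [Mono f] :
    ch L X ≤ ch L Y := by
  rw [ch_of_shortExact hL (shortExact_cokernel f)]
  exact le_self_add

lemma ch_le_of_epi (hL : IsSimpleLabelling L) {X Y : C} (f : X ⟶ Y) [Epi f] :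
    ch L Y ≤ ch L X := by
  rw [ch_of_shortExact hL (shortExact_kernel f)]
  exact le_add_self

lemma isIso_of_epi_of_ch_le (hL : IsSimpleLabelling L) {X Y : C} (f : X ⟶ Y) [Epi f]
    (h : ch L X ≤ ch L Y) : IsIso f := by
  refine isIso_of_shortExact_of_isZero_left (shortExact_kernel f) (isZero_of_ch_eq_zero hL ?_)
  have := ch_of_shortExact hL (shortExact_kernel f)
  ext l
  have h₁ := h l
  rw [this] at h₁
  simpa using h₁

lemma isIso_of_mono_of_ch_le (hL : IsSimpleLabelling L) {X Y : C} (f : X ⟶ Y) [Mono f]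
    (h : ch L Y ≤ ch L X) : IsIso f := by
  refine isIso_of_shortExact_of_isZero_right (shortExact_cokernel f) (isZero_of_ch_eq_zero hL ?_)
  have := ch_of_shortExact hL (shortExact_cokernel f)
  ext l
  have h₁ := h l
  rw [this] at h₁
  simpa using h₁

lemma FactorsIn.of_mono (hL : IsSimpleLabelling L) {Ω : Set Λ} {X Y : C} (f : X ⟶ Y) [Mono f]
    (h : FactorsIn L Ω Y) : FactorsIn L Ω X := fun l hl =>
  h l (by have := ch_le_of_mono hL f l; omega)

lemma FactorsIn.of_epi (hL : IsSimpleLabelling L) {Ω : Set Λ} {X Y : C} (f : X ⟶ Y) [Epi f]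
    (h : FactorsIn L Ω X) : FactorsIn L Ω Y := fun l hl =>
  h l (by have := ch_le_of_epi hL f l; omega)

lemma FactorsIn.of_shortExact (hL : IsSimpleLabelling L) {Ω : Set Λ} {S : ShortComplex C}
    (hS : S.ShortExact) (h₁ : FactorsIn L Ω S.X₁) (h₃ : FactorsIn L Ω S.X₃) :
    FactorsIn L Ω S.X₂ := fun l hl => by
  rw [ch_eq_add hL S hS, Finsupp.add_apply] at hl
  by_cases h : ch L S.X₁ l = 0
  · exact h₃ l (by omega)
  · exact h₁ l h

lemma factorsIn_isZero (hL : IsSimpleLabelling L) (Ω : Set Λ) {X : C} (hX : IsZero X) :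
    FactorsIn L Ω X := fun l hl => by simp [ch_of_isZero hL hX] at hl

lemma factorsIn_simple (hL : IsSimpleLabelling L) {Ω : Set Λ} {l : Λ} (hl : l ∈ Ω) :
    FactorsIn L Ω (L l) := fun m hm => by
  classical
  rw [ch_simple hL, Finsupp.single_apply] at hm
  split_ifs at hm with h
  · exact h ▸ hl
  · exact (hm rfl).elim

lemma isSerreClass_factorsIn (hL : IsSimpleLabelling L) (Ω : Set Λ) :
    (FactorsIn L Ω).IsSerreClass :=
  { toContainsZero := ⟨_, isZero_zero C, factorsIn_isZero hL Ω (isZero_zero C)⟩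
    toIsClosedUnderSubobjects := ⟨fun f _ h => h.of_mono hL f⟩
    toIsClosedUnderQuotients := ⟨fun f _ h => h.of_epi hL f⟩
    toIsClosedUnderExtensions := ⟨fun hS h₁ h₃ => FactorsIn.of_shortExact hL hS h₁ h₃⟩ }

/-- Dévissage along a composition series. -/
lemma FactorsIn.induction (hL : IsSimpleLabelling L) {Ω : Set Λ} {P : C → Prop}
    (zero : ∀ X, IsZero X → P X) (simple : ∀ l ∈ Ω, P (L l))
    (ext : ∀ S : ShortComplex C, S.ShortExact → P S.X₁ → P S.X₃ → P S.X₂) {X : C}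
    (hX : FactorsIn L Ω X) : P X := by
  induction X using finite_length_induction with
  | zero X h => exact zero X h
  | @step A X T i p w hS hT ih =>
    obtain ⟨l, ⟨e⟩⟩ := hL.exhaustive _ hT
    have : Mono i := hS.mono_f
    have : Epi p := hS.epi_g
    have hl : l ∈ Ω := (hX.of_epi hL p) l (by rw [ch_of_iso hL e, ch_simple hL]; simp)
    exact ext _ (shortExact_of_iso_right hS e) (ih (hX.of_mono hL i)) (simple l hl)

/-- This makes membership in a truncation a condition on the character, which is what allows objects
to be moved between the truncations of two orders. -/
lemma serreSub_eq_factorsIn (hL : IsSimpleLabelling L) (Ω : Set Λ) :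
    serreSub L Ω = FactorsIn L Ω := by
  funext X
  refine propext ⟨fun h => h _ (isSerreClass_factorsIn hL Ω) ?_, fun h Q hQ hLQ => ?_⟩
  · rintro Y ⟨l, hl, ⟨e⟩⟩
    exact FactorsIn.of_mono hL e.hom (factorsIn_simple hL hl)
  · refine FactorsIn.induction hL (fun Y hY => ?_) (fun l hl => hLQ _ ⟨l, hl, ⟨Iso.refl _⟩⟩)
      (fun S hS h₁ h₃ => Q.prop_X₂_of_shortExact hS h₁ h₃) h
    exact Q.prop_of_isZero hY

lemma HasMultiplicity.ch_eq (hL : IsSimpleLabelling L) {X : C} {l : Λ} {m : ℕ}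
    (h : HasMultiplicity X (L l) m) : ch L X l = m := by
  classical
  obtain ⟨F, rfl⟩ := h
  have hsum : ∀ (n : ℕ) (g : Fin (n + 1) → ℕ) (f : Fin n → ℕ), g 0 = 0 →
      (∀ i, g i.succ = g i.castSucc + f i) → g (Fin.last n) = ∑ i, f i := by
    intro n
    induction n with
    | zero => intro g f h0 _; simpa using h0
    | succ n ih =>
      intro g f h0 h
      rw [Fin.sum_univ_castSucc, ← Fin.succ_last, h,
        ← ih (fun i => g i.castSucc) (fun i => f i.castSucc) h0 fun i => h i.castSucc]
  have h₁ : ch L X l = ch L (F.term (Fin.last F.length) : C) l := by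
    rw [F.term_last, ch_of_iso hL (asIso (⊤ : Subobject X).arrow)]
  have h₂ : ch L (F.term 0 : C) l = 0 := by
    rw [F.term_zero, ch_of_isZero hL ((isZero_zero C).of_iso Subobject.botCoeIsoZero)]
    rfl
  rw [h₁, hsum F.length (fun i => ch L (F.term i : C) l) (fun i => ch L (F.factor i) l) h₂
    fun i => by
      rw [ch_of_shortExact hL (shortExact_cokernel (Subobject.ofLE _ _ (F.step i)))]
      rfl]
  have h₃ : ∀ i, ch L (F.factor i) l = if Nonempty (F.factor i ≅ L l) then 1 else 0 := by
    intro i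
    obtain ⟨m, ⟨e⟩⟩ := hL.exhaustive _ (F.simple i)
    have e' : F.factor i ≅ L m := e
    rw [ch_of_iso hL e', ch_simple hL, Finsupp.single_apply]
    refine if_congr ⟨?_, ?_⟩ rfl rfl
    · rintro rfl
      exact ⟨e'⟩
    · rintro ⟨f⟩
      exact hL.injective _ _ ⟨e'.symm ≪≫ f⟩
  simp only [h₃]
  rw [Finset.sum_boole, Nat.card_eq_fintype_card, Fintype.card_subtype]
  simp

end FactorsIn

/-! ### Injectivity, projectivity, hulls and covers relative to a subcategory. -/

section FullSubcategory

lemma mono_of_mono_hom {C : Type u} [Category.{v} C] {P : ObjectProperty C}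
    {X Y : P.FullSubcategory} (f : X ⟶ Y) [h : Mono f.hom] : Mono f :=
  P.ι.mono_of_mono_map h

lemma epi_of_epi_hom {C : Type u} [Category.{v} C] {P : ObjectProperty C}
    {X Y : P.FullSubcategory} (f : X ⟶ Y) [h : Epi f.hom] : Epi f :=
  P.ι.epi_of_epi_map h

variable {C : Type u} [Category.{v} C] [Abelian C] {P : ObjectProperty C}

lemma mono_hom_of_mono [P.IsClosedUnderSubobjects] {X Y : P.FullSubcategory} (f : X ⟶ Y)
    [Mono f] : Mono f.hom := by
  refine Preadditive.mono_of_kernel_zero ?_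
  let K : P.FullSubcategory := ⟨kernel f.hom, P.prop_of_mono (kernel.ι f.hom) X.property⟩
  let a : K ⟶ X := ObjectProperty.homMk (kernel.ι f.hom)
  let b : K ⟶ X := ObjectProperty.homMk 0
  have : a ≫ f = b ≫ f := ObjectProperty.hom_ext _ (by simp [a, b])
  exact congrArg (fun x => x.hom) ((cancel_mono f).mp this)

lemma epi_hom_of_epi [P.IsClosedUnderQuotients] {X Y : P.FullSubcategory} (f : X ⟶ Y)
    [Epi f] : Epi f.hom := by
  refine Preadditive.epi_of_cokernel_zero ?_
  let K : P.FullSubcategory := ⟨cokernel f.hom, P.prop_of_epi (cokernel.π f.hom) Y.property⟩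
  let a : Y ⟶ K := ObjectProperty.homMk (cokernel.π f.hom)
  let b : Y ⟶ K := ObjectProperty.homMk 0
  have : f ≫ a = f ≫ b := ObjectProperty.hom_ext _ (by simp [a, b])
  exact congrArg (fun x => x.hom) ((cancel_epi f).mp this)

end FullSubcategory

section Relative

variable {C : Type u} [Category.{v} C]

/-- Morphisms to `N` extend along monomorphisms between objects satisfying `P`. -/
def InjectiveOn (P : ObjectProperty C) (N : C) : Prop :=
  ∀ ⦃A B : C⦄ (i : A ⟶ B) (f : A ⟶ N), Mono i → P A → P B → ∃ g : B ⟶ N, i ≫ g = f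

/-- Morphisms from `D` lift along epimorphisms between objects satisfying `P`. -/
def ProjectiveOn (P : ObjectProperty C) (D : C) : Prop :=
  ∀ ⦃A B : C⦄ (p : A ⟶ B) (f : D ⟶ B), Epi p → P A → P B → ∃ g : D ⟶ A, g ≫ p = f

lemma InjectiveOn.of_injective {P : ObjectProperty C} {N : C} (h : P N)
    (hN : Injective (⟨N, h⟩ : P.FullSubcategory)) : InjectiveOn P N := by
  intro A B i f hi hA hB
  let i' : (⟨A, hA⟩ : P.FullSubcategory) ⟶ ⟨B, hB⟩ := ObjectProperty.homMk i
  let f' : (⟨A, hA⟩ : P.FullSubcategory) ⟶ ⟨N, h⟩ := ObjectProperty.homMk f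
  have : Mono i'.hom := hi
  have : Mono i' := mono_of_mono_hom i'
  exact ⟨(Injective.factorThru f' i').hom,
    congrArg (fun x => x.hom) (Injective.comp_factorThru f' i')⟩

lemma ProjectiveOn.of_projective {P : ObjectProperty C} {D : C} (h : P D)
    (hD : Projective (⟨D, h⟩ : P.FullSubcategory)) : ProjectiveOn P D := by
  intro A B p f hp hA hB
  let p' : (⟨A, hA⟩ : P.FullSubcategory) ⟶ ⟨B, hB⟩ := ObjectProperty.homMk p
  let f' : (⟨D, h⟩ : P.FullSubcategory) ⟶ ⟨B, hB⟩ := ObjectProperty.homMk f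
  have : Epi p'.hom := hp
  have : Epi p' := epi_of_epi_hom p'
  exact ⟨(Projective.factorThru f' p').hom,
    congrArg (fun x => x.hom) (Projective.factorThru_comp f' p')⟩

/-- An injective hull of `S` relative to the objects satisfying `P`. -/
structure IsRelInjectiveHull (P : ObjectProperty C) {S N : C} (i : S ⟶ N) : Prop where
  mem : P N
  mono : Mono i
  essential : ∀ ⦃Y : C⦄ (f : N ⟶ Y), Mono (i ≫ f) → Mono f
  injectiveOn : InjectiveOn P N

/-- A projective cover of `S` relative to the objects satisfying `P`. -/
structure IsRelProjectiveCover (P : ObjectProperty C) {D S : C} (p : D ⟶ S) : Prop where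
  mem : P D
  epi : Epi p
  essential : ∀ ⦃Y : C⦄ (f : Y ⟶ D), Epi (f ≫ p) → Epi f
  projectiveOn : ProjectiveOn P D

variable [Abelian C]

lemma IsInjectiveHull.isRelInjectiveHull {P : ObjectProperty C} [P.IsClosedUnderSubobjects]
    [P.IsClosedUnderQuotients] {S N : P.FullSubcategory} {i : S ⟶ N} (h : IsInjectiveHull i) :
    IsRelInjectiveHull P i.hom where
  mem := N.property
  mono := have := h.mono; mono_hom_of_mono i
  essential Y f hf := by
    -- The target of `f` need not lie in the subcategory, but its image does, as a quotient of `N`.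
    let J : P.FullSubcategory := ⟨image f, P.prop_of_epi (factorThruImage f) N.property⟩
    let g : N ⟶ J := ObjectProperty.homMk (factorThruImage f)
    have : Mono (i.hom ≫ factorThruImage f) := by
      have h' : (i.hom ≫ factorThruImage f) ≫ image.ι f = i.hom ≫ f := by simp
      exact mono_of_mono_fac h'
    have : Mono (i ≫ g).hom := this
    have : Mono g := h.essential g (mono_of_mono_hom _)
    have : Mono (factorThruImage f) := mono_hom_of_mono g
    rw [← image.fac f]
    infer_instance
  injectiveOn := .of_injective N.property h.injective

lemma IsProjectiveCover.isRelProjectiveCover {P : ObjectProperty C} [P.IsClosedUnderSubobjects]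
    [P.IsClosedUnderQuotients] {D S : P.FullSubcategory} {p : D ⟶ S} (h : IsProjectiveCover p) :
    IsRelProjectiveCover P p.hom where
  mem := D.property
  epi := have := h.epi; epi_hom_of_epi p
  essential Y f hf := by
    let J : P.FullSubcategory := ⟨image f, P.prop_of_mono (image.ι f) D.property⟩
    let g : J ⟶ D := ObjectProperty.homMk (image.ι f)
    have : Epi (image.ι f ≫ p.hom) := by
      have h' : factorThruImage f ≫ image.ι f ≫ p.hom = f ≫ p.hom := by simp
      exact epi_of_epi_fac h'
    have : Epi (g ≫ p).hom := this
    have : Epi g := h.essential g (epi_of_epi_hom _)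
    have : Epi (image.ι f) := epi_hom_of_epi g
    rw [← image.fac f]
    infer_instance
  projectiveOn := .of_projective D.property h.projective

end Relative

/-! ### Effect of the duality on hulls and characters. -/

section Duality

open Opposite

variable {C : Type u} [Category.{v} C] [Abelian C]

lemma ProjectiveOn.duality {P : ObjectProperty C} {Ψ : Cᵒᵖ ≌ C}
    (hP : ∀ X, P (Ψ.functor.obj (op X)) → P X) (hiso : ∀ {X Y : C}, (X ≅ Y) → P X → P Y) {N : C}
    (hN : InjectiveOn P N) : ProjectiveOn P (Ψ.functor.obj (op N)) := by
  intro A B p f hp hA hB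
  let A' := Ψ.functor.objPreimage A
  let B' := Ψ.functor.objPreimage B
  let a : Ψ.functor.obj A' ≅ A := Ψ.functor.objObjPreimageIso A
  let b : Ψ.functor.obj B' ≅ B := Ψ.functor.objObjPreimageIso B
  obtain ⟨p', hp'⟩ := Ψ.functor.map_surjective (a.hom ≫ p ≫ b.inv)
  obtain ⟨f', hf'⟩ := Ψ.functor.map_surjective (f ≫ b.inv)
  have h₁ : Epi p' := by
    refine Ψ.functor.epi_of_epi_map ?_
    rw [hp']
    infer_instance
  obtain ⟨g, hg⟩ := hN p'.unop f'.unop inferInstance (hP _ (hiso b.symm hB))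
    (hP _ (hiso a.symm hA))
  refine ⟨Ψ.functor.map g.op ≫ a.hom, ?_⟩
  rw [← cancel_mono b.inv, ← hf', Category.assoc, Category.assoc, ← hp', ← Functor.map_comp]
  exact congrArg Ψ.functor.map (Quiver.Hom.unop_inj hg)

lemma IsRelInjectiveHull.duality {P : ObjectProperty C} {Ψ : Cᵒᵖ ≌ C}
    (hP : ∀ X, P (Ψ.functor.obj (op X)) ↔ P X) (hiso : ∀ {X Y : C}, (X ≅ Y) → P X → P Y)
    {S N : C} {i : S ⟶ N} (h : IsRelInjectiveHull P i) :
    IsRelProjectiveCover P (Ψ.functor.map i.op) where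
  mem := (hP N).mpr h.mem
  epi := by
    have := h.mono
    infer_instance
  essential Y f hf := by
    let Y' := Ψ.functor.objPreimage Y
    let e : Ψ.functor.obj Y' ≅ Y := Ψ.functor.objObjPreimageIso Y
    obtain ⟨f', hf'⟩ := Ψ.functor.map_surjective (e.hom ≫ f)
    have h₁ : Epi (f' ≫ i.op) := by
      refine Ψ.functor.epi_of_epi_map ?_
      rw [Functor.map_comp, hf', Category.assoc]
      infer_instance
    have h₂ : Mono (i ≫ f'.unop) := inferInstanceAs (Mono (f' ≫ i.op).unop)
    have h₃ : Mono f'.unop := h.essential _ h₂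
    have h₄ : Epi f' := inferInstanceAs (Epi f'.unop.op)
    have h₅ : Epi (e.hom ≫ f) := by
      rw [← hf']
      infer_instance
    exact epi_of_epi e.hom f
  projectiveOn := ProjectiveOn.duality (fun X => (hP X).mp) hiso h.injectiveOn

variable {Λ : Type t} {L : Λ → C}
  [∀ X : C, IsNoetherianObject X] [∀ X : C, IsArtinianObject X]

/-- The duality is exact and reverses composition series; since it fixes the simple objects up to
isomorphism, the count of factors is unchanged. -/
lemma ch_duality (hL : IsSimpleLabelling L) {Ψ : Cᵒᵖ ≌ C} (hΨ : SimplePreserving Ψ) (X : C) :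
    ch L (Ψ.functor.obj (op X)) = ch L X := by
  induction X using finite_length_induction with
  | zero X hX => rw [ch_of_isZero hL hX, ch_of_isZero hL (Ψ.functor.map_isZero hX.op)]
  | step i p w hS hT ih =>
    rw [ch_of_shortExact hL hS, ← ih]
    have h := ch_eq_add hL _ (hS.op.map_of_exact Ψ.functor)
    obtain ⟨e⟩ := hΨ _ hT
    exact h.trans (by rw [add_comm]; exact congrArg _ (ch_of_iso hL e))

end Duality

universe w s

open Abelian

/-! ### Dévissage of `Ext`, and splitting of extensions in truncations. -/

section Devissage

variable {C : Type u} [Category.{v} C] [Abelian C] [HasExt.{w} C] {Λ : Type t} {L : Λ → C}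
  [∀ X : C, IsNoetherianObject X] [∀ X : C, IsArtinianObject X] (hL : IsSimpleLabelling L)

include hL

lemma subsingleton_ext_of_factorsIn {Ω : Set Λ} {X Y : C} {n : ℕ}
    (h : ∀ l ∈ Ω, Subsingleton (Ext X (L l) n)) (hY : FactorsIn L Ω Y) :
    Subsingleton (Ext X Y n) :=
  FactorsIn.induction hL (P := fun Y => Subsingleton (Ext X Y n))
    (fun _ hZ => subsingleton_of_forall_eq 0 (ext_eq_zero_of_isZero_right hZ)) h
    (fun _ hS => subsingleton_ext_X₂_right hS X n) hY

lemma subsingleton_ext_of_factorsIn_left {Ω : Set Λ} {X Y : C} {n : ℕ}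
    (h : ∀ l ∈ Ω, Subsingleton (Ext (L l) Y n)) (hX : FactorsIn L Ω X) :
    Subsingleton (Ext X Y n) :=
  FactorsIn.induction hL (P := fun X => Subsingleton (Ext X Y n))
    (fun _ hZ => subsingleton_of_forall_eq 0 (ext_eq_zero_of_isZero_left hZ)) h
    (fun _ hS => subsingleton_ext_X₂_left hS Y n) hX

/-- An extension in `C` of two objects of the Serre subcategory stays in it, so relative
projectivity already splits it. -/
lemma ext_one_subsingleton_of_projectiveOn {Ω : Set Λ} {D Y : C} (hD : FactorsIn L Ω D)
    (h : ProjectiveOn (FactorsIn L Ω) D) (hY : FactorsIn L Ω Y) : Subsingleton (Ext D Y 1) := by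
  refine subsingleton_of_forall_eq 0 fun e => ?_
  obtain ⟨E, i, p, w, hS, rfl⟩ := exists_extClass_eq e
  obtain ⟨g, hg⟩ := h p (𝟙 D) hS.epi_g (FactorsIn.of_shortExact hL hS hY hD) hD
  have h₁ := hS.comp_extClass
  have h₂ := congrArg (fun x => (Ext.mk₀ g).comp x (zero_add 1)) h₁
  simp only [Ext.comp_zero] at h₂
  rw [← Ext.mk₀_id_comp hS.extClass, ← h₂, ← hg, ← Ext.mk₀_comp_mk₀,
    Ext.comp_assoc_of_second_deg_zero]

lemma ext_one_subsingleton_of_injectiveOn {Ω : Set Λ} {N X : C} (hN : FactorsIn L Ω N)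
    (h : InjectiveOn (FactorsIn L Ω) N) (hX : FactorsIn L Ω X) : Subsingleton (Ext X N 1) := by
  refine subsingleton_of_forall_eq 0 fun e => ?_
  obtain ⟨E, i, p, w, hS, rfl⟩ := exists_extClass_eq e
  obtain ⟨g, hg⟩ := h i (𝟙 N) hS.mono_f hN (FactorsIn.of_shortExact hL hS hN hX)
  have h₁ := hS.extClass_comp
  have h₂ := congrArg (fun x => x.comp (Ext.mk₀ g) (add_zero 1)) h₁
  simp only [Ext.zero_comp] at h₂
  rw [← Ext.comp_mk₀_id hS.extClass, ← h₂, ← hg, ← Ext.mk₀_comp_mk₀,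
    Ext.comp_assoc_of_second_deg_zero]

end Devissage

/-! ### Higher `Ext` from standard to costandard objects. -/

section Homological

lemma finite_ext_zero (k : Type s) [Field k] {C : Type u} [Category.{v} C] [Abelian C]
    [HasExt.{w} C] [Linear k C] (hk : ∀ X Y : C, Module.Finite k (X ⟶ Y)) (X Y : C) :
    Module.Finite k (Ext X Y 0) :=
  have := hk X Y
  Module.Finite.equiv (Ext.linearEquiv₀ (R := k) (X := X) (Y := Y)).symm

variable {C : Type u} [Category.{v} C] [Abelian C] [HasExt.{w} C] {Λ : Type t}

/-- The properties of the standard objects `D l`, with their tops `p l : D l ⟶ L l`, and of the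
costandard objects `N l`, with their socles `i l : L l ⟶ N l`, of a lower finite highest weight
category with a simple preserving duality. -/
structure IsHighestWeightSystem (L : Λ → C) [PartialOrder Λ] {N D : Λ → C}
    (i : ∀ l, L l ⟶ N l) (p : ∀ l, D l ⟶ L l) : Prop where
  finite : ∀ l : Λ, (Set.Iic l).Finite
  hull : ∀ l, IsRelInjectiveHull (FactorsIn L (Set.Iic l)) (i l)
  cover : ∀ l, IsRelProjectiveCover (FactorsIn L (Set.Iic l)) (p l)
  ch_hull : ∀ l, ch L (N l) l = 1
  ch_cover : ∀ l, ch L (D l) = ch L (N l)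
  projectiveOn : ∀ (l : Λ) (Ω : Set Λ), Ω.Finite → IsLowerSet Ω → Maximal (· ∈ Ω) l →
    ProjectiveOn (FactorsIn L Ω) (D l)
  ext_two : ∀ l m, Subsingleton (Ext (D l) (N m) 2)

namespace IsHighestWeightSystem

variable {L : Λ → C} [PartialOrder Λ] {N D : Λ → C} {i : ∀ l, L l ⟶ N l} {p : ∀ l, D l ⟶ L l}

/-- `X` has no first extensions by costandard objects. -/
def ExtOneVanishes (N : Λ → C) (X : C) : Prop := ∀ m, Subsingleton (Ext X (N m) 1)

lemma wellFoundedLT (h : IsHighestWeightSystem L i p) : WellFoundedLT Λ :=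
  StrictMono.wellFoundedLT (f := fun l : Λ => (Set.Iic l).ncard) fun _ b hab =>
    Set.ncard_lt_ncard (Set.Iic_ssubset_Iic.mpr hab) (h.finite b)

lemma shortExact_hull (h : IsHighestWeightSystem L i p) (l : Λ) :
    (ShortComplex.mk (i l) (cokernel.π (i l)) (cokernel.condition _)).ShortExact :=
  have := (h.hull l).mono
  shortExact_cokernel (i l)

lemma shortExact_cover (h : IsHighestWeightSystem L i p) (l : Λ) :
    (ShortComplex.mk (kernel.ι (p l)) (p l) (kernel.condition _)).ShortExact :=
  have := (h.cover l).epi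
  shortExact_kernel (p l)

variable [∀ X : C, IsNoetherianObject X] [∀ X : C, IsArtinianObject X]

variable (hL : IsSimpleLabelling L) (h : IsHighestWeightSystem L i p)

include hL h

lemma factorsIn_cokernel (l : Λ) : FactorsIn L (Set.Iio l) (cokernel (i l)) := by
  intro m hm
  have h₁ := ch_of_shortExact hL (h.shortExact_hull l)
  rw [ch_simple hL] at h₁
  have h₂ : m ≤ l := (h.hull l).mem m fun h₀ => hm (by
    rw [h₁, Finsupp.add_apply] at h₀
    omega)
  refine lt_of_le_of_ne h₂ ?_
  rintro rfl
  have h₃ := h.ch_hull m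
  rw [h₁, Finsupp.add_apply, Finsupp.single_eq_same] at h₃
  omega

lemma factorsIn_kernel (l : Λ) : FactorsIn L (Set.Iio l) (kernel (p l)) := by
  intro m hm
  have h₁ := ch_of_shortExact hL (h.shortExact_cover l)
  rw [ch_simple hL] at h₁
  have h₂ : m ≤ l := (h.cover l).mem m fun h₀ => hm (by
    rw [h₁, Finsupp.add_apply] at h₀
    omega)
  refine lt_of_le_of_ne h₂ ?_
  rintro rfl
  have h₃ := h.ch_hull m
  rw [← h.ch_cover, h₁, Finsupp.add_apply, Finsupp.single_eq_same] at h₃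
  omega

lemma ext_one_standard_simple {l m : Λ} (hlm : ¬ l < m) : Subsingleton (Ext (D l) (L m) 1) := by
  -- In this finite ideal `l` is maximal exactly because `l < m` fails.
  let Ω : Set Λ := Set.Iic l ∪ Set.Iic m
  refine ext_one_subsingleton_of_projectiveOn hL (Ω := Ω)
    ((h.cover l).mem.mono Set.subset_union_left)
    (h.projectiveOn l Ω ((h.finite l).union (h.finite m))
      ((isLowerSet_Iic l).union (isLowerSet_Iic m)) ⟨Or.inl le_rfl, ?_⟩)
    (factorsIn_simple hL (Or.inr le_rfl))
  rintro a (ha | ha) hla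
  · exact ha
  · obtain rfl | hlt := eq_or_lt_of_le hla
    · exact le_rfl
    · exact (hlm (hlt.trans_le ha)).elim

/-- If `l < m`, both objects lie in the truncation at `m`, where `N m` is injective. Otherwise no
factor `L a` of `N m` has `l < a`, and each contributes zero. -/
lemma extOneVanishes_standard (l : Λ) : ExtOneVanishes N (D l) := by
  intro m
  by_cases hlm : l < m
  · exact ext_one_subsingleton_of_injectiveOn hL (h.hull m).mem (h.hull m).injectiveOn
      ((h.cover l).mem.mono (Set.Iic_subset_Iic.mpr hlm.le))
  · exact subsingleton_ext_of_factorsIn hL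
      (fun a ha => h.ext_one_standard_simple hL fun hla => hlm (hla.trans_le ha)) (h.hull m).mem

/-- Split off a standard quotient of `X`. Its kernel again has no first extensions by costandard
objects, because `Ext^2(Δ, ∇) = 0`, and it is shorter. -/
lemma ext_two_of_extOneVanishes {X : C} (hX : ExtOneVanishes N X) (m : Λ) :
    Subsingleton (Ext X (N m) 2) := by
  induction hn : (ch L X).degree using Nat.strong_induction_on generalizing X with
  | _ n ih =>
  subst hn
  by_cases hX0 : IsZero X
  · exact subsingleton_of_forall_eq 0 (ext_eq_zero_of_isZero_left hX0)
  have := h.wellFoundedLT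
  -- For `l` minimal with `Hom(X, L l) ≠ 0`, there are no maps from `X` to `N a / L a` for `a < l`.
  -- Hence `Ext^1(X, L a) = 0` for these `a`, and a nonzero map `X ⟶ L l` lifts to `D l`; the lift
  -- is epi as `p l` is essential.
  obtain ⟨l, hl, hmin⟩ := (wellFounded_lt (α := Λ)).has_min
    {l | ¬ Subsingleton (Ext X (L l) 0)} (by
      by_contra hempty
      rw [Set.not_nonempty_iff_eq_empty, Set.eq_empty_iff_forall_notMem] at hempty
      -- Without maps to any simple object, dévissage of the target gives `Hom(X, X) = 0`.
      have h₀ := subsingleton_ext_of_factorsIn hL (Y := X) (n := 0)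
        (fun l _ => not_not.mp (hempty l)) (factorsIn_univ X)
      refine hX0 ((IsZero.iff_id_eq_zero X).mpr ?_)
      exact Ext.homEquiv₀.symm.injective (Subsingleton.elim _ _))
  have hhom : ∀ a < l, Subsingleton (Ext X (L a) 0) := fun a ha => by
    by_contra h₀
    exact hmin a h₀ ha
  have hext : ∀ a < l, Subsingleton (Ext X (L a) 1) := fun a ha =>
    subsingleton_ext_X₁_right (h.shortExact_hull a) X 0 (hX a)
      (subsingleton_ext_of_factorsIn hL (fun b hb => hhom b (lt_trans hb ha))
        (h.factorsIn_cokernel hL a))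
  have hK : Subsingleton (Ext X (kernel (p l)) 1) :=
    subsingleton_ext_of_factorsIn hL hext (h.factorsIn_kernel hL l)
  obtain ⟨f, hf⟩ : ∃ f : X ⟶ L l, f ≠ 0 := by
    by_contra! h₀
    refine hl (subsingleton_of_forall_eq 0 fun x => ?_)
    obtain ⟨f, rfl⟩ := Ext.homEquiv₀.symm.surjective x
    rw [h₀ f]
    simp
  obtain ⟨g, hg⟩ := Ext.covariant_sequence_exact₃ X (h.shortExact_cover l) (Ext.mk₀ f)
    (n₁ := 1) rfl (Subsingleton.elim _ _)
  obtain ⟨g, rfl⟩ := Ext.homEquiv₀.symm.surjective g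
  have hgf : g ≫ p l = f := by
    refine Ext.homEquiv₀.symm.injective ?_
    simpa using hg
  have := hL.simple l
  have : Epi f := epi_of_nonzero_to_simple hf
  have : Epi g := (h.cover l).essential g (by rwa [hgf])
  have hS := shortExact_kernel g
  have hdeg : (ch L (kernel g)).degree < (ch L X).degree := by
    rw [ch_of_shortExact hL hS, map_add, Nat.lt_add_right_iff_pos, Nat.pos_iff_ne_zero, ne_eq,
      Finsupp.degree_eq_zero_iff, h.ch_cover]
    intro h₀
    simpa [h₀] using h.ch_hull l
  exact subsingleton_ext_X₂_left hS (N m) 2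
    (ih _ hdeg (fun a => subsingleton_ext_X₁_left hS (N a) 1 (hX a) (h.ext_two l a)) rfl)
    (h.ext_two l m)

lemma ext_two_simple {X : C} (hX : ExtOneVanishes N X) {Ω : Set Λ} (hΩ : IsLowerSet Ω)
    (hXΩ : ∀ l ∈ Ω, Subsingleton (Ext X (L l) 1)) {l : Λ} (hl : l ∈ Ω) :
    Subsingleton (Ext X (L l) 2) :=
  subsingleton_ext_X₁_right (h.shortExact_hull l) X 1 (h.ext_two_of_extOneVanishes hL hX l)
    (subsingleton_ext_of_factorsIn hL (fun a ha => hXΩ a (hΩ (le_of_lt ha) hl))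
      (h.factorsIn_cokernel hL l))

section Linear

variable (k : Type s) [Field k] [Linear k C] (hk : ∀ X Y : C, Module.Finite k (X ⟶ Y))

include hk

/-- Since `Ext^1(X, N l) = 0`, the group `Ext^1(X, L l)` is a quotient of the finite-dimensional
`Hom(X, N l / L l)`. The dimension serves as the induction measure in `exists_epi_ext_standard`. -/
lemma finite_ext_one {X : C} (hX : ExtOneVanishes N X) (Y : C) : Module.Finite k (Ext X Y 1) := by
  refine FactorsIn.induction hL (P := fun Y => Module.Finite k (Ext X Y 1)) (fun Z hZ => ?_)
    (fun l _ => ?_) (fun S hS _ _ => finite_ext_X₂_right k hS X 1) (factorsIn_univ Y)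
  · have : Subsingleton (Ext X Z 1) := subsingleton_of_forall_eq 0 (ext_eq_zero_of_isZero_right hZ)
    infer_instance
  · have := hX l
    have := finite_ext_zero k hk X (cokernel (i l))
    exact finite_ext_X₁_right k (h.shortExact_hull l) X 0

/-- Replace `X` by the middle term of a nonsplit extension by `D l` until none is left. As `D l` has
no self-extensions, the dimension of `Ext^1(X, D l)` drops each time; as `Ext^1(D l, L m) = 0`
unless `l < m`, earlier vanishing at such `m` persists. -/
lemma exists_epi_ext_standard {X : C} (hX : ExtOneVanishes N X) (l : Λ) :
    ∃ (X' : C) (g : X' ⟶ X), Epi g ∧ ExtOneVanishes N X' ∧ Subsingleton (Ext X' (D l) 1) ∧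
      ∀ m, ¬ l < m → Subsingleton (Ext X (L m) 1) → Subsingleton (Ext X' (L m) 1) := by
  induction hn : Module.finrank k (Ext X (D l) 1) using Nat.strong_induction_on
    generalizing X with
  | _ n ih =>
  subst hn
  by_cases h₀ : ∀ e : Ext X (D l) 1, e = 0
  · exact ⟨X, 𝟙 X, inferInstance, hX, subsingleton_of_forall_eq 0 h₀, fun _ _ => id⟩
  push Not at h₀
  obtain ⟨e, he⟩ := h₀
  obtain ⟨E, a, q, w, hS, rfl⟩ := exists_extClass_eq e
  have hE : ExtOneVanishes N E := fun m =>
    subsingleton_ext_X₂_left hS (N m) 1 (h.extOneVanishes_standard hL l m) (hX m)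
  have hDD : Subsingleton (Ext (D l) (D l) 1) :=
    subsingleton_ext_of_factorsIn hL
      (fun b hb => h.ext_one_standard_simple hL (not_lt_of_ge hb)) (h.cover l).mem
  let φ : Ext X (D l) 1 →ₗ[k] Ext E (D l) 1 := (Ext.mk₀ q).precompOfLinear k (D l) (zero_add 1)
  have hsurj : Function.Surjective φ := fun x =>
    Ext.contravariant_sequence_exact₂ hS (D l) x (Subsingleton.elim _ _)
  -- The chosen class dies when pulled back to its own middle term.
  have hker : (⟨hS.extClass, hS.comp_extClass⟩ : LinearMap.ker φ) ≠ 0 := fun h₀ =>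
    he (congrArg Subtype.val h₀)
  have := h.finite_ext_one hL k hk hX (D l)
  have hlt : Module.finrank k (Ext E (D l) 1) < Module.finrank k (Ext X (D l) 1) := by
    have h₁ := LinearMap.finrank_range_add_finrank_ker φ
    rw [LinearMap.range_eq_top.mpr hsurj, finrank_top] at h₁
    have : Nontrivial (LinearMap.ker φ) := nontrivial_of_ne _ _ hker
    have : 0 < Module.finrank k (LinearMap.ker φ) := Module.finrank_pos
    omega
  obtain ⟨X', g, hg, h₁, h₂, h₃⟩ := ih _ hlt hE rfl
  have : Epi q := hS.epi_g
  exact ⟨X', g ≫ q, inferInstance, h₁, h₂, fun m hm hXm => h₃ m hm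
    (subsingleton_ext_X₂_left hS (L m) 1 (h.ext_one_standard_simple hL hm) hXm)⟩

/-- Treat the elements of `Ω` from below, a maximal one `m` last: killing `Ext^1(-, D m)` does not
spoil the others, since none of them lies above `m`. -/
lemma exists_epi_ext_simple {X : C} (hX : ExtOneVanishes N X) {Ω : Set Λ} (hfin : Ω.Finite)
    (hΩ : IsLowerSet Ω) :
    ∃ (X' : C) (g : X' ⟶ X), Epi g ∧ ExtOneVanishes N X' ∧
      ∀ l ∈ Ω, Subsingleton (Ext X' (L l) 1) := by
  induction hn : Ω.ncard generalizing Ω with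
  | zero =>
    rw [Set.ncard_eq_zero hfin] at hn
    subst hn
    exact ⟨X, 𝟙 X, inferInstance, hX, fun l hl => hl.elim⟩
  | succ n ih =>
    have hne : Ω.Nonempty := by
      rw [← Set.ncard_pos hfin]
      omega
    obtain ⟨m, hm⟩ := hfin.exists_maximal hne
    have hΩ' : IsLowerSet (Ω \ {m}) := by
      rintro a b hba ⟨ha, ham⟩
      refine ⟨hΩ hba ha, ?_⟩
      rintro rfl
      exact ham (le_antisymm (hm.2 ha hba) hba)
    obtain ⟨Y, f, hf, hY, hYΩ⟩ := ih (hfin.subset Set.sdiff_subset) hΩ' (by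
      rw [Set.ncard_sdiff_singleton_of_mem hm.1, hn, Nat.add_sub_cancel])
    obtain ⟨Z, g, hg, hZ, hZm, hZΩ⟩ := h.exists_epi_ext_standard hL k hk hY m
    have hZΩ' : ∀ l ∈ Ω \ {m}, Subsingleton (Ext Z (L l) 1) := fun l hl =>
      hZΩ l (fun hml => not_lt_of_ge (hm.2 hl.1 hml.le) hml) (hYΩ l hl)
    refine ⟨Z, g ≫ f, inferInstance, hZ, fun l hl => ?_⟩
    by_cases hlm : l = m
    · subst hlm
      -- `Ext^1(Z, L l)` sits between `Ext^1(Z, D l)` and `Ext^2(Z, kernel (p l))`; the latter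
      -- involves only simples already treated.
      refine subsingleton_ext_X₃_right (h.shortExact_cover l) Z 1 hZm
        (subsingleton_ext_of_factorsIn hL (fun a ha => ?_) (h.factorsIn_kernel hL l))
      exact h.ext_two_simple hL hZ hΩ' hZΩ' ⟨hΩ (le_of_lt ha) hl, ne_of_lt ha⟩
    · exact hZΩ' l ⟨hl, hlm⟩

lemma exists_epi_extOneVanishes (M : C) :
    ∃ (X : C) (f : X ⟶ M), Epi f ∧ ExtOneVanishes N X := by
  let Ω : Set Λ := ⋃ l ∈ (ch L M).support, Set.Iic l
  have hfin : Ω.Finite := (ch L M).support.finite_toSet.biUnion fun l _ => h.finite l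
  have hΩ : IsLowerSet Ω := isLowerSet_iUnion₂ fun l _ => isLowerSet_Iic l
  have hM : FactorsIn L Ω M := fun l hl =>
    Set.mem_biUnion (Finsupp.mem_support_iff.mpr hl) (Set.mem_Iic.mpr le_rfl)
  -- A horseshoe argument over the fixed finite ideal `Ω`: lifting the cover of `S.X₃` to `S.X₂`
  -- requires that it have no first extension by `S.X₁`, hence the stronger claim with `FactorsIn`
  -- and vanishing on `Ω`.
  suffices hsuff : FactorsIn L Ω M ∧ ∃ (X : C) (f : X ⟶ M), Epi f ∧ ExtOneVanishes N X ∧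
      ∀ l ∈ Ω, Subsingleton (Ext X (L l) 1) by
    obtain ⟨-, X, f, hf, hX, -⟩ := hsuff
    exact ⟨X, f, hf, hX⟩
  refine FactorsIn.induction hL (P := fun M => FactorsIn L Ω M ∧ ∃ (X : C) (f : X ⟶ M), Epi f ∧
      ExtOneVanishes N X ∧ ∀ l ∈ Ω, Subsingleton (Ext X (L l) 1))
    (fun Z hZ => ⟨factorsIn_isZero hL Ω hZ, Z, 𝟙 Z, inferInstance, fun m => ?_, fun l _ => ?_⟩)
    (fun l hl => ?_) (fun S hS => ?_) hM
  · exact subsingleton_of_forall_eq 0 (ext_eq_zero_of_isZero_left hZ)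
  · exact subsingleton_of_forall_eq 0 (ext_eq_zero_of_isZero_left hZ)
  · obtain ⟨X, f, hf, hX, hXΩ⟩ := h.exists_epi_ext_simple hL k hk
      (h.extOneVanishes_standard hL l) hfin hΩ
    have := (h.cover l).epi
    exact ⟨factorsIn_simple hL hl, X, f ≫ p l, inferInstance, hX, hXΩ⟩
  · rintro ⟨hS₁, X₁, f₁, hf₁, hX₁, hX₁'⟩ ⟨hS₃, X₃, f₃, hf₃, hX₃, hX₃'⟩
    have hext := subsingleton_ext_of_factorsIn hL hX₃' hS₁
    obtain ⟨g, hg⟩ := Ext.covariant_sequence_exact₃ X₃ hS (Ext.mk₀ f₃)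
      (n₁ := 1) rfl (Subsingleton.elim _ _)
    obtain ⟨g, rfl⟩ := Ext.homEquiv₀.symm.surjective g
    have hgf : g ≫ S.g = f₃ := by
      refine Ext.homEquiv₀.symm.injective ?_
      simpa using hg
    have hB := (ShortComplex.Splitting.ofHasBinaryBiproduct X₁ X₃).shortExact
    refine ⟨FactorsIn.of_shortExact hL hS hS₁ hS₃, X₁ ⊞ X₃, biprod.desc (f₁ ≫ S.f) g, ?_,
      fun m => subsingleton_ext_X₂_left hB _ 1 (hX₁ m) (hX₃ m),
      fun l hl => subsingleton_ext_X₂_left hB _ 1 (hX₁' l hl) (hX₃' l hl)⟩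
    refine Preadditive.epi_of_cancel_zero _ fun {T} a ha => ?_
    have h₁ : S.f ≫ a = 0 := by
      rw [← cancel_epi f₁]
      simpa using congrArg (fun x => biprod.inl ≫ x) ha
    obtain ⟨b, rfl⟩ := exists_desc_of_shortExact hS a h₁
    have h₃ : f₃ ≫ b = 0 := by
      rw [← hgf, Category.assoc]
      simpa using congrArg (fun x => biprod.inr ≫ x) ha
    rw [(cancel_epi f₃).mp (h₃.trans comp_zero.symm), comp_zero]

/-- Dimension shifting: a class is effaced by an epimorphism whose source may be taken good. The
kernel is good by `ext_two_of_extOneVanishes`, and the class comes from one of lower degree on it.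
-/
lemma ext_costandard {X : C} (hX : ExtOneVanishes N X) (n : ℕ) (m : Λ) :
    Subsingleton (Ext X (N m) (n + 1)) := by
  induction n generalizing X with
  | zero => exact hX m
  | succ n ih =>
    refine subsingleton_of_forall_eq 0 fun e => ?_
    obtain ⟨Y, f, hf, he⟩ := exists_epi_comp_eq_zero e
    obtain ⟨Z, g, hg, hZ⟩ := h.exists_epi_extOneVanishes hL k hk Y
    have hS := shortExact_kernel (g ≫ f)
    have hK : ExtOneVanishes N (kernel (g ≫ f)) := fun a =>
      subsingleton_ext_X₁_left hS (N a) 1 (hZ a) (h.ext_two_of_extOneVanishes hL hX a)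
    have := ih hK
    obtain ⟨e', rfl⟩ := Ext.contravariant_sequence_exact₃ hS (N m) e (n₀ := n + 1) (by
      rw [← Ext.mk₀_comp_mk₀, Ext.comp_assoc_of_second_deg_zero, he, Ext.comp_zero])
      (add_comm 1 _)
    rw [Subsingleton.elim e' 0, Ext.comp_zero]

end Linear

end IsHighestWeightSystem

end Homological

/-! ### Finiteness of total `Ext` along short exact sequences. -/

section FiniteExt

variable {k : Type s} [Field k] {C : Type u} [Category.{v} C] [Abelian C] [Linear k C]
  [HasExt.{w} C]

lemma FiniteExt.of_isZero_left {X Y : C} (hX : IsZero X) : FiniteExt k X Y :=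
  have (n : ℕ) : Subsingleton (Ext X Y n) :=
    subsingleton_of_forall_eq 0 (ext_eq_zero_of_isZero_left hX)
  ⟨fun _ => inferInstance, 0, fun n _ => this n⟩

lemma FiniteExt.of_isZero_right {X Y : C} (hY : IsZero Y) : FiniteExt k X Y :=
  have (n : ℕ) : Subsingleton (Ext X Y n) :=
    subsingleton_of_forall_eq 0 (ext_eq_zero_of_isZero_right hY)
  ⟨fun _ => inferInstance, 0, fun n _ => this n⟩

variable {S : ShortComplex C} (hS : S.ShortExact)

include hS

lemma FiniteExt.X₂_left {Y : C} (h₁ : FiniteExt k S.X₁ Y) (h₃ : FiniteExt k S.X₃ Y) :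
    FiniteExt k S.X₂ Y where
  finite n :=
    have := h₁.finite n
    have := h₃.finite n
    finite_of_exact ((Ext.mk₀ S.g).precompOfLinear k Y (zero_add n))
      ((Ext.mk₀ S.f).precompOfLinear k Y (zero_add n))
      ((ShortComplex.ab_exact_iff_function_exact _).mp
        (Ext.contravariant_sequence_exact₂' hS Y n))
  bounded := by
    obtain ⟨N₁, hN₁⟩ := h₁.bounded
    obtain ⟨N₃, hN₃⟩ := h₃.bounded
    exact ⟨N₁ + N₃, fun n hn => subsingleton_ext_X₂_left hS Y n (hN₁ n (by omega))
      (hN₃ n (by omega))⟩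

lemma FiniteExt.X₂_right {X : C} (h₁ : FiniteExt k X S.X₁) (h₃ : FiniteExt k X S.X₃) :
    FiniteExt k X S.X₂ where
  finite n :=
    have := h₁.finite n
    have := h₃.finite n
    finite_ext_X₂_right k hS X n
  bounded := by
    obtain ⟨N₁, hN₁⟩ := h₁.bounded
    obtain ⟨N₃, hN₃⟩ := h₃.bounded
    exact ⟨N₁ + N₃, fun n hn => subsingleton_ext_X₂_right hS X n (hN₁ n (by omega))
      (hN₃ n (by omega))⟩

lemma FiniteExt.X₃_left (hk : ∀ X Y : C, Module.Finite k (X ⟶ Y)) {Y : C}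
    (h₁ : FiniteExt k S.X₁ Y) (h₂ : FiniteExt k S.X₂ Y) : FiniteExt k S.X₃ Y where
  finite n := by
    cases n with
    | zero => exact finite_ext_zero k hk _ _
    | succ n =>
      have := h₁.finite n
      have := h₂.finite (n + 1)
      exact finite_of_exact (hS.extClass.precompOfLinear k Y (add_comm 1 n))
        ((Ext.mk₀ S.g).precompOfLinear k Y (zero_add (n + 1)))
        ((ShortComplex.ab_exact_iff_function_exact _).mp
          (Ext.contravariant_sequence_exact₃' hS Y n (n + 1) (add_comm 1 n)))
  bounded := by
    obtain ⟨N₁, hN₁⟩ := h₁.bounded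
    obtain ⟨N₂, hN₂⟩ := h₂.bounded
    refine ⟨N₁ + N₂ + 1, fun n hn => ?_⟩
    obtain ⟨n, rfl⟩ : ∃ m, n = m + 1 := ⟨n - 1, by omega⟩
    exact subsingleton_ext_X₃_left hS Y n (hN₂ _ (by omega)) (hN₁ n (by omega))

lemma FiniteExt.X₁_right (hk : ∀ X Y : C, Module.Finite k (X ⟶ Y)) {X : C}
    (h₂ : FiniteExt k X S.X₂) (h₃ : FiniteExt k X S.X₃) : FiniteExt k X S.X₁ where
  finite n := by
    cases n with
    | zero => exact finite_ext_zero k hk _ _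
    | succ n =>
      have := h₃.finite n
      have := h₂.finite (n + 1)
      exact finite_ext_X₁_right k hS X n
  bounded := by
    obtain ⟨N₂, hN₂⟩ := h₂.bounded
    obtain ⟨N₃, hN₃⟩ := h₃.bounded
    refine ⟨N₂ + N₃ + 1, fun n hn => ?_⟩
    obtain ⟨n, rfl⟩ : ∃ m, n = m + 1 := ⟨n - 1, by omega⟩
    exact subsingleton_ext_X₁_right hS X n (hN₂ _ (by omega)) (hN₃ n (by omega))

end FiniteExt

/-! ### The Euler form as a bilinear form on characters. -/

section IntegralCharacter

variable {C : Type u} [Category.{v} C] [Abelian C] {Λ : Type t} (L : Λ → C)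

/-- The character with integral coefficients. -/
noncomputable def intCh (X : C) : Λ →₀ ℤ :=
  (ch L X).mapRange (fun n : ℕ => (n : ℤ)) rfl

lemma intCh_apply (X : C) (l : Λ) : intCh L X l = ch L X l := rfl

variable {L} [∀ X : C, IsNoetherianObject X] [∀ X : C, IsArtinianObject X]
  (hL : IsSimpleLabelling L)

include hL

lemma intCh_of_shortExact {S : ShortComplex C} (hS : S.ShortExact) :
    intCh L S.X₂ = intCh L S.X₁ + intCh L S.X₃ := by
  ext l
  simp [intCh_apply, ch_eq_add hL S hS]

lemma intCh_of_isZero {X : C} (hX : IsZero X) : intCh L X = 0 := by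
  ext l
  simp [intCh_apply, ch_of_isZero hL hX]

lemma intCh_simple (l : Λ) : intCh L (L l) = Finsupp.single l 1 := by
  simp [intCh, ch_simple hL]

end IntegralCharacter

section EulerCharacter

variable (k : Type s) [Field k] {C : Type u} [Category.{v} C] [Abelian C] [Linear k C]
  [HasExt.{w} C] {Λ : Type t} (L : Λ → C)

/-- The value of the Euler form on formal combinations of simple objects. -/
noncomputable def eulerPairing : (Λ →₀ ℤ) →ₗ[ℤ] (Λ →₀ ℤ) →ₗ[ℤ] ℤ :=
  Finsupp.lsum ℤ fun l => (LinearMap.toSpanSingleton ℤ _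
    (Finsupp.lsum ℤ fun m => LinearMap.toSpanSingleton ℤ ℤ (eulerForm k (L l) (L m))))

lemma eulerPairing_single (l m : Λ) :
    eulerPairing k L (Finsupp.single l 1) (Finsupp.single m 1) = eulerForm k (L l) (L m) := by
  simp [eulerPairing]

variable {k L} [∀ X : C, IsNoetherianObject X] [∀ X : C, IsArtinianObject X]

lemma eulerForm_eq_eulerPairing (hL : IsSimpleLabelling L) (hfin : ∀ X Y : C, FiniteExt k X Y)
    (X Y : C) :
    eulerForm k X Y = eulerPairing k L (intCh L X) (intCh L Y) := by
  have hsimple : ∀ l, eulerForm k (L l) Y = eulerPairing k L (intCh L (L l)) (intCh L Y) := by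
    intro l
    refine FactorsIn.induction hL (P := fun Y => eulerForm k (L l) Y =
      eulerPairing k L (intCh L (L l)) (intCh L Y)) (fun Z hZ => ?_) (fun m _ => ?_)
      (fun S hS h₁ h₃ => ?_) (factorsIn_univ Y)
    · rw [intCh_of_isZero hL hZ, map_zero, eulerForm_eq_sum (N := 0) fun n _ =>
        subsingleton_of_forall_eq 0 (ext_eq_zero_of_isZero_right hZ)]
      simp
    · rw [intCh_simple hL, intCh_simple hL, eulerPairing_single]
    · rw [eulerForm_right hS (L l) (hfin _ _) (hfin _ _) (hfin _ _), h₁, h₃,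
        intCh_of_shortExact hL hS, map_add]
  refine FactorsIn.induction hL (P := fun X => eulerForm k X Y =
      eulerPairing k L (intCh L X) (intCh L Y)) (fun Z hZ => ?_) (fun m _ => hsimple m)
      (fun S hS h₁ h₃ => ?_) (factorsIn_univ X)
  · rw [intCh_of_isZero hL hZ, map_zero, eulerForm_eq_sum (N := 0) fun n _ =>
        subsingleton_of_forall_eq 0 (ext_eq_zero_of_isZero_left hZ)]
    simp
  · rw [eulerForm_left hS Y (hfin _ _) (hfin _ _) (hfin _ _), h₁, h₃,
        intCh_of_shortExact hL hS, map_add, LinearMap.add_apply]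

end EulerCharacter

/-! ### Orthonormality of the costandard characters. -/

namespace IsHighestWeightSystem

section

variable {C : Type u} [Category.{v} C] [Abelian C] [HasExt.{w} C] {Λ : Type t}
  {L : Λ → C} [PartialOrder Λ] {N D : Λ → C} {i : ∀ l, L l ⟶ N l} {p : ∀ l, D l ⟶ L l}

/-- A projective cover of `L l` has no other simple quotient: the kernel of a nonzero `f` cannot map
onto `L l` by essentiality, so `p l` factors through `f`. -/
lemma ext_zero_standard_simple (hL : IsSimpleLabelling L)
    (h : IsHighestWeightSystem L i p) {l m : Λ} (hlm : m ≠ l) :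
    Subsingleton (Ext (D l) (L m) 0) := by
  refine subsingleton_of_forall_eq 0 fun x => ?_
  obtain ⟨f, rfl⟩ := Ext.homEquiv₀.symm.surjective x
  suffices hf : f = 0 by simp [hf]
  by_contra hf
  have := hL.simple
  have := (h.cover l).epi
  have : Epi f := epi_of_nonzero_to_simple hf
  by_cases h₀ : kernel.ι f ≫ p l = 0
  · obtain ⟨r, hr⟩ := exists_desc_of_shortExact (shortExact_kernel f) (p l) h₀
    have hr0 : r ≠ 0 := by
      rintro rfl
      rw [comp_zero] at hr
      exact Simple.not_isZero (L l) (IsZero.of_epi_eq_zero (p l) hr.symm)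
    have : IsIso r := isIso_of_hom_simple hr0
    exact hlm (hL.injective _ _ ⟨asIso r⟩)
  · have : Epi (kernel.ι f ≫ p l) := epi_of_nonzero_to_simple h₀
    have : Epi (kernel.ι f) := (h.cover l).essential _ this
    exact hf ((cancel_epi (kernel.ι f)).mp (by rw [kernel.condition, comp_zero]))

lemma ext_zero_simple_costandard (hL : IsSimpleLabelling L)
    (h : IsHighestWeightSystem L i p) {l m : Λ} (hlm : l ≠ m) :
    Subsingleton (Ext (L l) (N m) 0) := by
  refine subsingleton_of_forall_eq 0 fun x => ?_
  obtain ⟨f, rfl⟩ := Ext.homEquiv₀.symm.surjective x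
  suffices hf : f = 0 by simp [hf]
  by_contra hf
  have := hL.simple
  have := (h.hull m).mono
  have : Mono f := mono_of_nonzero_from_simple hf
  by_cases h₀ : i m ≫ cokernel.π f = 0
  · obtain ⟨r, hr⟩ := exists_lift_of_shortExact (shortExact_cokernel f) (i m) h₀
    have hr0 : r ≠ 0 := by
      rintro rfl
      rw [zero_comp] at hr
      exact Simple.not_isZero (L m) (IsZero.of_mono_eq_zero (i m) hr.symm)
    have : IsIso r := isIso_of_hom_simple hr0
    exact hlm (hL.injective _ _ ⟨(asIso r).symm⟩)
  · have : Mono (i m ≫ cokernel.π f) := mono_of_nonzero_from_simple h₀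
    have : Mono (cokernel.π f) := (h.hull m).essential _ this
    exact hf ((cancel_mono (cokernel.π f)).mp (by rw [cokernel.condition, zero_comp]))

variable [∀ X : C, IsNoetherianObject X] [∀ X : C, IsArtinianObject X]
  (hL : IsSimpleLabelling L) (h : IsHighestWeightSystem L i p)

include hL h

/-- If `l ≤ m`, then `L m`, the socle of `N m`, is not a factor of `D l`. Otherwise `L l`, the top
of `D l`, is not a factor of `N m`. -/
lemma ext_zero_standard_costandard {l m : Λ} (hlm : l ≠ m) :
    Subsingleton (Ext (D l) (N m) 0) := by
  by_cases hle : l ≤ m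
  · refine subsingleton_ext_of_factorsIn_left hL (fun a ha => ?_) (h.cover l).mem
    refine h.ext_zero_simple_costandard hL ?_
    rintro rfl
    exact hlm (le_antisymm hle ha)
  · refine subsingleton_ext_of_factorsIn hL (fun a ha => ?_) (h.hull m).mem
    refine h.ext_zero_standard_simple hL ?_
    rintro rfl
    exact hle ha

/-- The costandard characters are unitriangular with respect to the simple ones, and the order is
well-founded. -/
lemma span_intCh_costandard : Submodule.span ℤ (Set.range fun l => intCh L (N l)) = ⊤ := by
  have := h.wellFoundedLT
  let W := Submodule.span ℤ (Set.range fun l => intCh L (N l))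
  have hsimple : ∀ l, intCh L (L l) ∈ W := fun l => by
    induction l using WellFoundedLT.induction with
    | ind l ih =>
      have hQ : intCh L (cokernel (i l)) ∈ W :=
        FactorsIn.induction hL (P := fun X => intCh L X ∈ W)
          (fun Z hZ => by rw [intCh_of_isZero hL hZ]; exact W.zero_mem) ih
          (fun S hS h₁ h₃ => by rw [intCh_of_shortExact hL hS]; exact W.add_mem h₁ h₃)
          (h.factorsIn_cokernel hL l)
      have h₁ := intCh_of_shortExact hL (h.shortExact_hull l)
      rw [eq_sub_of_add_eq h₁.symm]
      exact W.sub_mem (Submodule.subset_span ⟨l, rfl⟩) hQ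
  refine eq_top_iff.mpr fun x _ => ?_
  induction x using Finsupp.induction_linear with
  | zero => exact W.zero_mem
  | add x y hx hy => exact W.add_mem (hx trivial) (hy trivial)
  | single l a =>
    have : Finsupp.single l a = a • Finsupp.single l (1 : ℤ) := by simp
    rw [this, ← intCh_simple hL l]
    exact W.smul_mem a (hsimple l)

variable (k : Type s) [Field k] [Linear k C] (hk : ∀ X Y : C, Module.Finite k (X ⟶ Y))

include hk

/-- `End(L l) → Hom(D l, L l) → Hom(D l, N l)` are bijections, as `L l` occurs neither in the kernel
of `p l` nor in the cokernel of `i l`; Schur's lemma over an algebraically closed field gives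
dimension one. -/
lemma finrank_hom_standard_costandard [IsAlgClosed k] (l : Λ) :
    Module.finrank k (Ext (D l) (N l) 0) = 1 := by
  have := hL.simple
  have := (h.cover l).epi
  have := (h.hull l).mono
  have := hk (L l) (L l)
  rw [← finrank_endomorphism_simple_eq_one k (L l),
    ← (Ext.linearEquiv₀ (R := k) (X := L l) (Y := L l)).finrank_eq]
  let φ : Ext (L l) (L l) 0 →ₗ[k] Ext (D l) (L l) 0 :=
    (Ext.mk₀ (p l)).precompOfLinear k (L l) (zero_add 0)
  let ψ : Ext (D l) (L l) 0 →ₗ[k] Ext (D l) (N l) 0 :=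
    (Ext.mk₀ (i l)).postcompOfLinear k (D l) (add_zero 0)
  have hφ : Function.Bijective φ := by
    refine ⟨Ext.precomp_mk₀_injective_of_epi (L l) (p l), fun x => ?_⟩
    have : Subsingleton (Ext (kernel (p l)) (L l) 0) := by
      refine subsingleton_ext_of_factorsIn_left hL (fun a ha => ?_) (h.factorsIn_kernel hL l)
      refine subsingleton_of_forall_eq 0 fun y => ?_
      obtain ⟨f, rfl⟩ := Ext.homEquiv₀.symm.surjective y
      suffices hf : f = 0 by simp [hf]
      by_contra hf
      have : IsIso f := isIso_of_hom_simple hf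
      exact ne_of_lt ha (hL.injective _ _ ⟨asIso f⟩)
    exact Ext.contravariant_sequence_exact₂ (h.shortExact_cover l) (L l) x (Subsingleton.elim _ _)
  have hψ : Function.Bijective ψ := by
    refine ⟨Ext.postcomp_mk₀_injective_of_mono (D l) (i l), fun x => ?_⟩
    have : Subsingleton (Ext (D l) (cokernel (i l)) 0) :=
      subsingleton_ext_of_factorsIn hL (fun a ha => h.ext_zero_standard_simple hL (ne_of_lt ha))
        (h.factorsIn_cokernel hL l)
    exact Ext.covariant_sequence_exact₂ (D l) (h.shortExact_hull l) x (Subsingleton.elim _ _)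
  exact ((LinearEquiv.ofBijective φ hφ).trans (LinearEquiv.ofBijective ψ hψ)).finrank_eq.symm

/-- Induction on `l`: `L l` is `D l` modulo an object with smaller factors, and `Ext` from `D l` to
`N m` lives in degree zero. -/
lemma finiteExt_costandard (X : C) (m : Λ) : FiniteExt k X (N m) := by
  have := h.wellFoundedLT
  have hD : ∀ l, FiniteExt k (D l) (N m) := fun l =>
    { finite := fun n => by
        cases n with
        | zero => exact finite_ext_zero k hk _ _
        | succ n =>
          have := h.ext_costandard hL k hk (h.extOneVanishes_standard hL l) n m
          infer_instance
      bounded := ⟨1, fun n hn => by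
        obtain ⟨n, rfl⟩ : ∃ a, n = a + 1 := ⟨n - 1, by omega⟩
        exact h.ext_costandard hL k hk (h.extOneVanishes_standard hL l) n m⟩ }
  have hsimple : ∀ l, FiniteExt k (L l) (N m) := fun l => by
    induction l using WellFoundedLT.induction with
    | ind l ih =>
      refine FiniteExt.X₃_left (h.shortExact_cover l) hk ?_ (hD l)
      exact FactorsIn.induction hL (P := fun X => FiniteExt k X (N m))
        (fun _ => FiniteExt.of_isZero_left) ih (fun _ hS => FiniteExt.X₂_left hS)
        (h.factorsIn_kernel hL l)
  exact FactorsIn.induction hL (P := fun X => FiniteExt k X (N m))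
    (fun _ => FiniteExt.of_isZero_left) (fun l _ => hsimple l) (fun _ hS => FiniteExt.X₂_left hS)
    (factorsIn_univ X)

lemma finiteExt (X Y : C) : FiniteExt k X Y := by
  have := h.wellFoundedLT
  have hsimple : ∀ l, FiniteExt k X (L l) := fun l => by
    induction l using WellFoundedLT.induction with
    | ind l ih =>
      refine FiniteExt.X₁_right (h.shortExact_hull l) hk (h.finiteExt_costandard hL k hk X l) ?_
      exact FactorsIn.induction hL (P := fun Y => FiniteExt k X Y)
        (fun _ => FiniteExt.of_isZero_right) ih (fun _ hS => FiniteExt.X₂_right hS)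
        (h.factorsIn_cokernel hL l)
  exact FactorsIn.induction hL (P := fun Y => FiniteExt k X Y)
    (fun _ => FiniteExt.of_isZero_right) (fun l _ => hsimple l) (fun _ hS => FiniteExt.X₂_right hS)
    (factorsIn_univ Y)

lemma eulerForm_standard_costandard [IsAlgClosed k] [DecidableEq Λ] (l m : Λ) :
    eulerForm k (D l) (N m) = if l = m then 1 else 0 := by
  rw [eulerForm_eq_sum (N := 1) fun n hn => ?_]
  · split_ifs with hlm
    · subst hlm
      simp [h.finrank_hom_standard_costandard hL k hk l]
    · have := h.ext_zero_standard_costandard hL hlm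
      have : Module.finrank k (Ext (D l) (N m) 0) = 0 := Module.finrank_zero_of_subsingleton
      simp [this]
  · obtain ⟨n, rfl⟩ : ∃ a, n = a + 1 := ⟨n - 1, by omega⟩
    exact h.ext_costandard hL k hk (h.extOneVanishes_standard hL l) n m

/-- The characters of the costandard objects are orthonormal with respect to the Euler form. -/
lemma eulerPairing_costandard [IsAlgClosed k] [DecidableEq Λ] (l m : Λ) :
    eulerPairing k L (intCh L (N l)) (intCh L (N m)) = if l = m then 1 else 0 := by
  rw [← h.eulerForm_standard_costandard hL k hk,
    eulerForm_eq_eulerPairing hL (h.finiteExt hL k hk)]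
  simp only [intCh, h.ch_cover]

end

end IsHighestWeightSystem

/-! ### Orthonormal families of nonnegative integral vectors. -/

section Orthonormal

/-- Two orthonormal families of nonnegative vectors in `ℤ^(Λ)`, of which the first one spans:
every vector of the second family belongs to the first one. -/
lemma exists_eq_of_orthonormal {Λ : Type t} [DecidableEq Λ]
    (B : (Λ →₀ ℤ) →ₗ[ℤ] (Λ →₀ ℤ) →ₗ[ℤ] ℤ) {v : Λ → Λ →₀ ℤ} {w : Λ →₀ ℤ}
    (hv : ∀ l m, B (v l) (v m) = if l = m then 1 else 0) (hw : B w w = 1)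
    (hspan : Submodule.span ℤ (Set.range v) = ⊤) (hv0 : ∀ l, 0 ≤ v l) (hw0 : 0 ≤ w) :
    ∃ m, w = v m := by
  have hwv : w ∈ Submodule.span ℤ (Set.range v) := by rw [hspan]; trivial
  obtain ⟨c, hc⟩ := (Finsupp.mem_span_range_iff_exists_finsupp).mp hwv
  -- The norm of `w` is the sum of the squares of its integral coordinates, so exactly one
  -- coordinate is nonzero, and it is `1` or `-1`.
  have hsq : ∑ l ∈ c.support, c l ^ 2 = 1 := by
    rw [← hw, ← hc, Finsupp.sum, map_sum B, LinearMap.sum_apply]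
    refine Finset.sum_congr rfl fun l hl => ?_
    rw [map_sum, Finset.sum_eq_single l]
    · simp [hv, sq]
    · intro m _ hml
      simp [hv, hml.symm]
    · exact fun h => (h hl).elim
  have hpos : ∀ l ∈ c.support, 1 ≤ c l ^ 2 := fun l hl => by
    have := Finsupp.mem_support_iff.mp hl
    have : 0 < c l ^ 2 := by positivity
    omega
  have hcard : c.support.card = 1 := by
    have h₁ : c.support.card ≤ 1 := by
      have := Finset.card_nsmul_le_sum c.support (fun l => c l ^ 2) 1 hpos
      rw [hsq] at this
      simpa using this
    have h₂ : c.support.card ≠ 0 := fun h₀ => by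
      rw [Finset.card_eq_zero.mp h₀] at hsq
      simp at hsq
    omega
  obtain ⟨m, hm⟩ := Finset.card_eq_one.mp hcard
  rw [hm, Finset.sum_singleton] at hsq
  rw [Finsupp.sum, hm, Finset.sum_singleton] at hc
  refine ⟨m, ?_⟩
  rcases sq_eq_one_iff.mp hsq with h₁ | h₁
  · rw [← hc, h₁, one_smul]
  -- With coefficient `-1`, both `v m` and `-v m` are nonnegative, so `v m = 0`, against its norm
  -- being `1`.
  · rw [h₁, neg_one_smul] at hc
    have h₀ : v m = 0 := le_antisymm (neg_nonneg.mp (hc ▸ hw0)) (hv0 m)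
    have h₂ := hv m m
    simp [h₀] at h₂

end Orthonormal

/-! ### Comparison of the characters of two structures. -/

section Comparison

lemma eq_of_injective_of_le {Λ : Type t} [PartialOrder Λ] [WellFoundedLT Λ] {σ : Λ → Λ}
    (hσ : Function.Injective σ) (hle : ∀ l, σ l ≤ l) (l : Λ) : σ l = l := by
  induction l using WellFoundedLT.induction with
  | ind l ih =>
    by_contra hne
    exact hne (hσ (ih _ (lt_of_le_of_ne (hle l) hne)))

variable {C : Type u} [Category.{v} C] [Abelian C] [HasExt.{w} C] {Λ : Type t} {L : Λ → C}
  [∀ X : C, IsNoetherianObject X] [∀ X : C, IsArtinianObject X]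

/-- The characters of the costandard objects do not depend on the highest weight structure. -/
lemma ch_costandard_eq (k : Type s) [Field k] [IsAlgClosed k] [Linear k C]
    (hk : ∀ X Y : C, Module.Finite k (X ⟶ Y)) (hL : IsSimpleLabelling L) {o₁ o₂ : PartialOrder Λ}
    {N₁ D₁ N₂ D₂ : Λ → C} {i₁ : ∀ l, L l ⟶ N₁ l} {p₁ : ∀ l, D₁ l ⟶ L l} {i₂ : ∀ l, L l ⟶ N₂ l}
    {p₂ : ∀ l, D₂ l ⟶ L l} (h₁ : @IsHighestWeightSystem _ _ _ _ _ L o₁ _ _ i₁ p₁)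
    (h₂ : @IsHighestWeightSystem _ _ _ _ _ L o₂ _ _ i₂ p₂) (l : Λ) :
    ch L (N₁ l) = ch L (N₂ l) := by
  classical
  have e₁ := @IsHighestWeightSystem.eulerPairing_costandard _ _ _ _ _ _ o₁ _ _ _ _ _ _ hL
    h₁ k _ _ hk _ _
  have e₂ := @IsHighestWeightSystem.eulerPairing_costandard _ _ _ _ _ _ o₂ _ _ _ _ _ _ hL
    h₂ k _ _ hk _ _
  have hex : ∀ l, ∃ m, intCh L (N₂ l) = intCh L (N₁ m) := fun l =>
    exists_eq_of_orthonormal (eulerPairing k L) e₁ (by simp [e₂])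
      (@IsHighestWeightSystem.span_intCh_costandard _ _ _ _ _ _ o₁ _ _ _ _ _ _ hL h₁)
      (fun m a => Nat.cast_nonneg _) (fun a => Nat.cast_nonneg _)
  choose σ hσ using hex
  have hch : ∀ l, ch L (N₂ l) = ch L (N₁ (σ l)) := fun l => by
    ext a
    have := DFunLike.congr_fun (hσ l) a
    simpa [intCh_apply] using this
  have hinj : Function.Injective σ := fun a b hab => by
    by_contra hne
    have h := e₂ a b
    rw [hσ a, hσ b, hab, e₁] at h
    simp [hne] at h
  -- `L (σ l)` is a factor of `N₁ (σ l)`, hence of `N₂ l`.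
  have hle : ∀ l, o₂.le (σ l) l := fun l => (h₂.hull l).mem (σ l) (by
    rw [hch, @IsHighestWeightSystem.ch_hull _ _ _ _ _ _ o₁ _ _ _ _ h₁]
    exact one_ne_zero)
  have := h₂.wellFoundedLT
  rw [hch, @eq_of_injective_of_le _ o₂ this _ hinj hle]

end Comparison

/-! ### From the axioms to the working data, and the theorem. -/

section Main

open Opposite

variable {C : Type u} [Category.{v} C] [Abelian C] {Λ : Type t} {L : Λ → C}
  [∀ X : C, IsNoetherianObject X] [∀ X : C, IsArtinianObject X]

/-- Essentiality makes the extensions in both directions monomorphisms, and finite length makes them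
isomorphisms. Two properties `P`, `P'` are allowed so that hulls for different orders can be
compared. -/
lemma IsRelInjectiveHull.nonempty_iso (hL : IsSimpleLabelling L) {P P' : ObjectProperty C}
    {S N N' : C} {i : S ⟶ N} {i' : S ⟶ N'} (h : IsRelInjectiveHull P i)
    (h' : IsRelInjectiveHull P' i') (hS : P S) (hS' : P' S) (hN : P' N) (hN' : P N') :
    Nonempty (N ≅ N') := by
  obtain ⟨f, hf⟩ := h'.injectiveOn i i' h.mono hS' hN
  obtain ⟨g, hg⟩ := h.injectiveOn i' i h'.mono hS hN'
  have : Mono f := h.essential f (by rw [hf]; exact h'.mono)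
  have : Mono g := h'.essential g (by rw [hg]; exact h.mono)
  have : IsIso f := isIso_of_mono_of_ch_le hL f (ch_le_of_mono hL g)
  exact ⟨asIso f⟩

lemma IsRelProjectiveCover.nonempty_iso (hL : IsSimpleLabelling L) {P : ObjectProperty C}
    {S S' D D' : C} {p : D ⟶ S} {p' : D' ⟶ S'} (e : S ≅ S') (h : IsRelProjectiveCover P p)
    (h' : IsRelProjectiveCover P p') (hS : P S) (hS' : P S') :
    Nonempty (D ≅ D') := by
  have := h.epi
  have := h'.epi
  obtain ⟨f, hf⟩ := h.projectiveOn p' (p ≫ e.hom) h'.epi h'.mem hS'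
  obtain ⟨g, hg⟩ := h'.projectiveOn p (p' ≫ e.inv) h.epi h.mem hS
  have : Epi f := h'.essential f (by rw [hf]; infer_instance)
  have : Epi g := h.essential g (by rw [hg]; infer_instance)
  have : IsIso f := isIso_of_epi_of_ch_le hL f (ch_le_of_epi hL g)
  exact ⟨asIso f⟩

lemma IsCostandard.exists_isRelInjectiveHull (hL : IsSimpleLabelling L) {o : PartialOrder Λ}
    {l : Λ} {N : C} (h : IsCostandard L o l N) :
    ∃ i : L l ⟶ N, IsRelInjectiveHull (FactorsIn L {m | o.le m l}) i := by
  obtain ⟨hl, hN, i, hi⟩ := h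
  have := isSerreClass_factorsIn hL {m | o.le m l}
  rw [← serreSub_eq_factorsIn hL] at this ⊢
  exact ⟨i.hom, hi.isRelInjectiveHull⟩

lemma IsStandard.exists_isRelProjectiveCover (hL : IsSimpleLabelling L) {o : PartialOrder Λ}
    {l : Λ} {D : C} (h : IsStandard L o l D) :
    ∃ p : D ⟶ L l, IsRelProjectiveCover (FactorsIn L {m | o.le m l}) p := by
  obtain ⟨hl, hD, p, hp⟩ := h
  have := isSerreClass_factorsIn hL {m | o.le m l}
  rw [← serreSub_eq_factorsIn hL] at this ⊢
  exact ⟨p.hom, hp.isRelProjectiveCover⟩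

lemma factorsIn_duality_iff (hL : IsSimpleLabelling L) {Ψ : Cᵒᵖ ≌ C} (hΨ : SimplePreserving Ψ)
    (Ω : Set Λ) (X : C) : FactorsIn L Ω (Ψ.functor.obj (op X)) ↔ FactorsIn L Ω X := by
  simp only [FactorsIn, ch_duality hL hΨ]

lemma exists_isHighestWeightSystem (hL : IsSimpleLabelling L) {Ψ : Cᵒᵖ ≌ C}
    (hΨ : SimplePreserving Ψ) {o : PartialOrder Λ} (h : IsLowerFiniteHighestWeight L o) :
    letI : HasExt.{max u v} C := HasExt.standard C
    ∃ (N D : Λ → C) (i : ∀ l, L l ⟶ N l) (p : ∀ l, D l ⟶ L l),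
      IsHighestWeightSystem L i p ∧ ∀ l, IsCostandard L o l (N l) := by
  let : HasExt.{max u v} C := HasExt.standard C
  choose N hN using h.exists_costandard
  choose D hD using h.exists_standard
  choose i hi using fun l => (hN l).exists_isRelInjectiveHull hL
  choose p hp using fun l => (hD l).exists_isRelProjectiveCover hL
  have hiso : ∀ (Ω : Set Λ) {X Y : C}, (X ≅ Y) → FactorsIn L Ω X → FactorsIn L Ω Y :=
    fun Ω X Y e hX => hX.of_epi hL e.hom
  have hl : ∀ l, FactorsIn L {m | o.le m l} (L l) := fun l => factorsIn_simple hL (o.le_refl l)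
  -- The dual of `N l` is a projective cover of `L l` in the same truncation, so it is `D l`. This
  -- gives `D l` the character of `N l` and, by dualizing injectivity, projectivity in larger
  -- ideals.
  have hdual : ∀ l, Nonempty (D l ≅ Ψ.functor.obj (op (N l))) := fun l => by
    obtain ⟨e⟩ := hΨ (L l) (hL.simple l)
    exact (hp l).nonempty_iso hL e.symm
      ((hi l).duality (factorsIn_duality_iff hL hΨ _) (hiso _)) (hl l)
      (hiso _ e.symm (hl l))
  refine ⟨N, D, i, p, ⟨h.lowerFinite, hi, hp, fun l => (h.multiplicity_one l _ (hN l)).ch_eq hL,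
    fun l => ?_, fun l Ω hfin hΩ hmax => ?_, fun l m => h.ext_two l m _ _ (hD l) (hN m)⟩, hN⟩
  · obtain ⟨e⟩ := hdual l
    rw [ch_of_iso hL e, ch_duality hL hΨ]
  · obtain ⟨e⟩ := hdual l
    have hinj := h.costandard_injective l _ (hN l) Ω hfin hΩ hmax
    rw [serreSub_eq_factorsIn hL] at hinj
    obtain ⟨hNΩ, hNinj⟩ := hinj
    have hproj := ProjectiveOn.duality (Ψ := Ψ)
      (fun X => (factorsIn_duality_iff hL hΨ Ω X).mp) (hiso Ω)
      (InjectiveOn.of_injective hNΩ hNinj)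
    intro A B q f hq hA hB
    obtain ⟨g, hg⟩ := hproj q (e.inv ≫ f) hq hA hB
    exact ⟨e.hom ≫ g, by rw [Category.assoc, hg, Iso.hom_inv_id_assoc]⟩

end Main

end LFHW

theorem mainTheorem1 {k : Type*} [Field k] [IsAlgClosed k]
    {C : Type*} [Category C] [Abelian C] [Linear k C] [LFHW.IsFiniteLengthCategory k C]
    {Λ : Type*} (L : Λ → C) (hL : LFHW.IsSimpleLabelling L)
    (Ψ : Cᵒᵖ ≌ C) (hΨ : LFHW.SimplePreserving Ψ)
    (o₁ o₂ : PartialOrder Λ)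
    (h₁ : LFHW.IsLowerFiniteHighestWeight L o₁) (h₂ : LFHW.IsLowerFiniteHighestWeight L o₂) :
    LFHW.EquivalentStructures L o₁ o₂ := by
  have : ∀ X : C, IsNoetherianObject X := LFHW.IsFiniteLengthCategory.noetherian k
  have : ∀ X : C, IsArtinianObject X := LFHW.IsFiniteLengthCategory.artinian k
  have hk : ∀ X Y : C, Module.Finite k (X ⟶ Y) := LFHW.IsFiniteLengthCategory.finite_hom
  let := HasExt.standard C
  obtain ⟨N₁, D₁, i₁, p₁, hs₁, hN₁⟩ := LFHW.exists_isHighestWeightSystem hL hΨ h₁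
  obtain ⟨N₂, D₂, i₂, p₂, hs₂, hN₂⟩ := LFHW.exists_isHighestWeightSystem hL hΨ h₂
  intro l M₁ M₂ hM₁ hM₂
  obtain ⟨j₁, hj₁⟩ := hM₁.exists_isRelInjectiveHull hL
  obtain ⟨j₂, hj₂⟩ := hM₂.exists_isRelInjectiveHull hL
  obtain ⟨n₁, hn₁⟩ := (hN₁ l).exists_isRelInjectiveHull hL
  obtain ⟨n₂, hn₂⟩ := (hN₂ l).exists_isRelInjectiveHull hL
  have hl₁ := LFHW.factorsIn_simple hL (Ω := {m | o₁.le m l}) (o₁.le_refl l)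
  have hl₂ := LFHW.factorsIn_simple hL (Ω := {m | o₂.le m l}) (o₂.le_refl l)
  obtain ⟨e₁⟩ := hj₁.nonempty_iso hL hn₁ hl₁ hl₁ hj₁.mem hn₁.mem
  obtain ⟨e₂⟩ := hj₂.nonempty_iso hL hn₂ hl₂ hl₂ hj₂.mem hn₂.mem
  have hch : LFHW.ch L M₁ = LFHW.ch L M₂ := by
    rw [LFHW.ch_of_iso hL e₁, LFHW.ch_of_iso hL e₂]
    exact LFHW.ch_costandard_eq k hk hL hs₁ hs₂ l
  -- Equality of characters puts `M₁` in the second truncation and `M₂` in the first.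
  exact hj₁.nonempty_iso hL hj₂ hl₁ hl₂ (fun m hm => hj₂.mem m (hch ▸ hm))
    (fun m hm => hj₁.mem m (hch ▸ hm))
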